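/- Let $\phi=\frac{1+\sqrt5}{2}$, let $\mathbb H^4=\{x\in\mathbb R^5 : -x_0^2+x_1^2+x_2^2+x_3^2+x_4^2=-1,\ x_0>0\}$, and let $\Gamma=\langle r_0,r_1,r_2,r_3,r_4\rangle$ be the group of isometries of $\mathbb H^4$ generated by the five reflections $$r_0:\ x_1\mapsto -x_1,\qquad r_1:\ x_1\leftrightarrow x_2,\qquad r_2:\ x_2\leftrightarrow x_3,\qquad r_3:\ x_3\leftrightarrow x_4,$$ $$r_4:\ (x_0,x_1,x_2,x_3,x_4)\mapsto(\phi x_0-\sqrt\phi\,x_4,\ x_1,\ x_2,\ x_3,\ \sqrt\phi\,x_0-\phi x_4)$$ (coordinates that are not mentioned are fixed). This is the symmetry group of the regular tessellation $\{4,3,3,5\}$ of $\mathbb H^4$. For $0\le i\le 4$ let $S_i$ be the subgroup of $\Gamma$ generated by the $r_j$ with $j\ne i$. The $i$-faces of $\{4,3,3,5\}$ are the left cosets $gS_i$, and two faces are incident if these cosets intersect. In the dual tessellation $\{5,3,3,4\}$ of $\mathbb H^4$ the $i$-faces are the $(4-i)$-faces of $\{4,3,3,5\}$, with the same incidence; its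 $0$-faces are called vertices, its $1$-faces edges, and its $4$-faces are 120-cells. A path of edges is a finite sequence of vertices $v_0,v_1,\dots,v_n$ of $\{5,3,3,4\}$ in which $v_{k-1}\neq v_k$ are the two ends of an edge for $1\le k\le n$; its length is $n$. It is minimal if no path of edges from $v_0$ to $v_n$ is shorter. A loop of edges is a path of edges of length $n\ge 1$ with $v_0=v_n$. Claim: for every loop of edges $v_0,v_1,\dots,v_n=v_0$ in the tessellation $\{5,3,3,4\}$ there are indices $0\le k\le l\le n$ such that the subpath $v_k,v_{k+1},\dots,v_l$ is not minimal and lies on a single $4$-face, that is, all its vertices and edges are incident to one and the same $4$-face. -/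

import Mathlib

open Matrix

namespace GoldenTessellation

noncomputable section

/-- The matrices of the five reflections `r₀, …, r₄` of the hyperboloid model
`-x₀² + x₁² + x₂² + x₃² + x₄² = -1`, `x₀ > 0` of hyperbolic 4-space in the walls of the
characteristic simplex of the regular tessellation `{4,3,3,5}`. -/
def reflMatrix : Fin 5 → Matrix (Fin 5) (Fin 5) ℝ :=
  ![!![1, 0, 0, 0, 0;
       0, -1, 0, 0, 0;
       0, 0, 1, 0, 0;
       0, 0, 0, 1, 0;
       0, 0, 0, 0, 1],
    !![1, 0, 0, 0, 0;
       0, 0, 1, 0, 0;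
       0, 1, 0, 0, 0;
       0, 0, 0, 1, 0;
       0, 0, 0, 0, 1],
    !![1, 0, 0, 0, 0;
       0, 1, 0, 0, 0;
       0, 0, 0, 1, 0;
       0, 0, 1, 0, 0;
       0, 0, 0, 0, 1],
    !![1, 0, 0, 0, 0;
       0, 1, 0, 0, 0;
       0, 0, 1, 0, 0;
       0, 0, 0, 0, 1;
       0, 0, 0, 1, 0],
    !![Real.goldenRatio, 0, 0, 0, -√Real.goldenRatio;
       0, 1, 0, 0, 0;
       0, 0, 1, 0, 0;
       0, 0, 0, 1, 0;
       √Real.goldenRatio, 0, 0, 0, -Real.goldenRatio]]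

theorem reflMatrix_mul_self (i : Fin 5) : reflMatrix i * reflMatrix i = 1 := by
  have h1 : √Real.goldenRatio * √Real.goldenRatio = Real.goldenRatio :=
    Real.mul_self_sqrt Real.goldenRatio_pos.le
  have h2 : Real.goldenRatio ^ 2 = Real.goldenRatio + 1 := Real.goldenRatio_sq
  unfold reflMatrix
  generalize √Real.goldenRatio = s at h1 ⊢
  generalize Real.goldenRatio = t at h1 h2 ⊢
  fin_cases i <;> ext a b <;> fin_cases a <;> fin_cases b <;>
    simp [Matrix.mul_apply, Fin.sum_univ_five] <;> linarith

/-- The reflections `r₀, …, r₄` as invertible matrices. -/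
def wallRefl (i : Fin 5) : GL (Fin 5) ℝ :=
  ⟨reflMatrix i, reflMatrix i, reflMatrix_mul_self i, reflMatrix_mul_self i⟩

/-- The symmetry group of the `{4,3,3,5}` tessellation of hyperbolic 4-space: the group of
isometries of the hyperboloid generated by `r₀, …, r₄`. -/
def Gam : Subgroup (GL (Fin 5) ℝ) := Subgroup.closure (Set.range wallRefl)

/-- The subgroup generated by the four reflections `r j` with `j ≠ i`, the stabilizer of the
base `i`-face. -/
def faceSubgroup (i : Fin 5) : Subgroup Gam :=
  Subgroup.closure {g : Gam | ∃ j : Fin 5, j ≠ i ∧ (g : GL (Fin 5) ℝ) = wallRefl j}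

/-- The `i`-faces of the `{4,3,3,5}` tessellation: left cosets of the stabilizer of the base
`i`-face. -/
abbrev CubeFace (i : Fin 5) : Type := Gam ⧸ faceSubgroup i

/-- Two faces of the `{4,3,3,5}` tessellation are incident when the corresponding cosets have a
common element. -/
def CubeIncident {i j : Fin 5} (F : CubeFace i) (F' : CubeFace j) : Prop :=
  ∃ g : Gam, (QuotientGroup.mk g : CubeFace i) = F ∧ (QuotientGroup.mk g : CubeFace j) = F'

/-- The `i`-faces of the dual tessellation `{5,3,3,4}`: the `(4 - i)`-faces of `{4,3,3,5}`. -/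
def Face (i : Fin 5) : Type := CubeFace i.rev

/-- Incidence of faces in the tessellation `{5,3,3,4}`; it is the one of the dual. -/
def Incident {i j : Fin 5} (F : Face i) (F' : Face j) : Prop :=
  CubeIncident (i := i.rev) (j := j.rev) F F'

/-- The graph of vertices and edges (the 1-skeleton) of the tessellation `{5,3,3,4}`. -/
def skeleton : SimpleGraph (Face 0) where
  Adj v w := v ≠ w ∧ ∃ e : Face 1, Incident v e ∧ Incident w e
  symm := ⟨fun _ _ ⟨hne, e, hv, hw⟩ => ⟨hne.symm, e, hw, hv⟩⟩
  loopless := ⟨fun _ h => h.1 rfl⟩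

/-- A path of edges is minimal if no path of edges with the same ends is shorter. -/
def IsMinimal {a b : Face 0} (p : skeleton.Walk a b) : Prop :=
  ∀ q : skeleton.Walk a b, p.length ≤ q.length

/-- A path of edges lies on the 4-face `P` if all its vertices and all its edges are incident
to `P`. -/
def LiesOn {a b : Face 0} (p : skeleton.Walk a b) (P : Face 4) : Prop :=
  (∀ v ∈ p.support, Incident v P) ∧
    ∀ s ∈ p.edges, ∃ e : Face 1, (∀ v ∈ s, Incident v e) ∧ Incident e P

end

end GoldenTessellation

open GoldenTessellation

/-!
The walls of `{5,3,3,4}` are the hyperplanes tiled by its 3-faces; they bound right-angled 120-cells.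
Call a walk *locally minimal* if its subwalks on a single 120-cell are minimal. The theorem says that
a closed walk of positive length is not locally minimal, and it follows from
`LocallyMinimal.side_ne_zero`: a locally minimal walk does not return to a wall that it leaves. Indeed
the first edge of a closed walk leaves the wall through its start that is perpendicular to it.

`LocallyMinimal.side_ne_zero` is proved by induction on the length. Let a shortest counterexample
leave the wall `H` at its first step and return to it at its last.
* If the walk crosses no wall, it lies on a single 120-cell (`exists_frames`), and is minimal there,
  with both ends on a facet. But a minimal walk on the 120-cell with both ends on a facet stays on
  the facet (`LocallyMinimal.side_ne_zero_of_isCellPath`).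
* Otherwise let `L` be the first wall that it crosses. By induction the walk, once off `L`, does not
  return to it, so its two ends are on different sides of `L`. They are both on `H`, hence `L` and `H`
  meet, and then they are perpendicular (`form_eq_zero_of_separate`). The part of the walk up to its
  arrival on `L` lies on a single 120-cell, leaves the facet on `H` at its first step and reaches the
  adjacent facet on `L` at its last. Such a walk is not minimal
  (`LocallyMinimal.not_reach_of_isCellPath`).

The two facts on the 120-cell are finite: vertices are taken up to the permutations of the space
coordinates, which leaves 45 classes, listed with their distances from the base vertex in
`vertexTable`, and `depth_le_move_zero` and `depth_le_of_wall` are checked by evaluation.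

The facts on walls are arithmetic. After a rescaling of the time coordinate, the group consists of
matrices over `ℤ[φ]` that preserve a Lorentzian form whose conjugate is definite. Walls are integral
vectors of norm one, so their conjugate coordinates are bounded; as a nonzero element of `ℤ[φ]` has
norm at least one, this bounds the real coordinates from below. Hence the walls through the base
vertex are the four coordinate hyperplanes (`IsWall.eq_axis`), edges are not crossed by walls
(`IsWall.not_cross_edge`), and walls that meet are perpendicular (`IsWall.not_separate`).
-/

namespace GoldenTessellation

/-! ### Distances on the 120-cell -/

/-- The ring `ℤ[φ]`, with `⟨a, b⟩` standing for `a + b φ`. -/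
abbrev ZPhi : Type := QuadraticAlgebra ℤ 1 1

namespace ZPhi

/-- The golden ratio as an element of `ℤ[φ]`. -/
def phi : ZPhi := ⟨0, 1⟩

end ZPhi

open ZPhi

/-- The orbit of a vector of `ℤ[φ]⁵` under the permutations of its four space coordinates: the time
coordinate and the multiset of the space coordinates. -/
abbrev Shape : Type := ZPhi × Multiset ZPhi

/-- The shape of the image under `r₄` of a vector of shape `t` whose last coordinate is `m`
(see `shape_reflVec_four`). -/
def Shape.move (t : Shape) (m : ZPhi) : Shape :=
  (phi * (t.1 - m), (t.1 - phi * m) ::ₘ t.2.erase m)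

/-- The shapes of the 600 vertices of the base 120-cell, each with its distance in the graph of
the 120-cell from the base vertex. That distance is a function of the shape because the stabilizer
of the base vertex and the base cell permutes the space coordinates. -/
def vertexTable : List (ZPhi × List ZPhi × ℕ) :=
  [
   ⟨⟨1, 0⟩, [⟨0, 0⟩, ⟨0, 0⟩, ⟨0, 0⟩, ⟨0, 0⟩], 0⟩,
   ⟨⟨0, 1⟩, [⟨0, 0⟩, ⟨0, 0⟩, ⟨0, 0⟩, ⟨1, 0⟩], 1⟩,
   ⟨⟨1, 1⟩, [⟨0, 0⟩, ⟨0, 0⟩, ⟨1, 0⟩, ⟨0, 1⟩], 2⟩,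
   ⟨⟨1, 2⟩, [⟨0, 0⟩, ⟨1, 0⟩, ⟨0, 1⟩, ⟨1, 1⟩], 3⟩,
   ⟨⟨2, 2⟩, [⟨0, 0⟩, ⟨0, 1⟩, ⟨1, 1⟩, ⟨1, 1⟩], 4⟩,
   ⟨⟨2, 3⟩, [⟨1, 0⟩, ⟨0, 1⟩, ⟨1, 1⟩, ⟨1, 2⟩], 4⟩,
   ⟨⟨1, 3⟩, [⟨0, 0⟩, ⟨1, 1⟩, ⟨1, 1⟩, ⟨1, 1⟩], 5⟩,
   ⟨⟨2, 4⟩, [⟨1, 0⟩, ⟨1, 1⟩, ⟨1, 2⟩, ⟨1, 2⟩], 5⟩,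
   ⟨⟨2, 4⟩, [⟨0, 1⟩, ⟨1, 1⟩, ⟨1, 1⟩, ⟨2, 2⟩], 5⟩,
   ⟨⟨3, 4⟩, [⟨0, 1⟩, ⟨1, 1⟩, ⟨1, 2⟩, ⟨2, 2⟩], 5⟩,
   ⟨⟨3, 4⟩, [⟨1, 0⟩, ⟨1, 2⟩, ⟨1, 2⟩, ⟨1, 2⟩], 6⟩,
   ⟨⟨3, 4⟩, [⟨1, 1⟩, ⟨1, 1⟩, ⟨1, 1⟩, ⟨1, 3⟩], 6⟩,
   ⟨⟨3, 5⟩, [⟨1, 1⟩, ⟨1, 1⟩, ⟨2, 2⟩, ⟨1, 3⟩], 6⟩,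
   ⟨⟨3, 5⟩, [⟨0, 1⟩, ⟨1, 2⟩, ⟨2, 2⟩, ⟨2, 2⟩], 6⟩,
   ⟨⟨4, 5⟩, [⟨1, 1⟩, ⟨1, 2⟩, ⟨1, 2⟩, ⟨2, 3⟩], 6⟩,
   ⟨⟨3, 6⟩, [⟨1, 1⟩, ⟨1, 2⟩, ⟨2, 2⟩, ⟨2, 3⟩], 6⟩,
   ⟨⟨4, 6⟩, [⟨1, 1⟩, ⟨2, 2⟩, ⟨1, 3⟩, ⟨2, 3⟩], 7⟩,
   ⟨⟨4, 6⟩, [⟨1, 2⟩, ⟨1, 2⟩, ⟨1, 2⟩, ⟨3, 3⟩], 7⟩,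
   ⟨⟨4, 7⟩, [⟨1, 2⟩, ⟨2, 2⟩, ⟨2, 2⟩, ⟨2, 4⟩], 7⟩,
   ⟨⟨4, 7⟩, [⟨1, 2⟩, ⟨1, 2⟩, ⟨2, 3⟩, ⟨3, 3⟩], 7⟩,
   ⟨⟨5, 7⟩, [⟨1, 2⟩, ⟨2, 2⟩, ⟨2, 3⟩, ⟨2, 4⟩], 7⟩,
   ⟨⟨5, 8⟩, [⟨2, 2⟩, ⟨2, 2⟩, ⟨2, 4⟩, ⟨2, 4⟩], 8⟩,
   ⟨⟨5, 8⟩, [⟨1, 2⟩, ⟨2, 3⟩, ⟨3, 3⟩, ⟨2, 4⟩], 8⟩,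
   ⟨⟨5, 8⟩, [⟨2, 2⟩, ⟨1, 3⟩, ⟨2, 3⟩, ⟨3, 4⟩], 8⟩,
   ⟨⟨5, 9⟩, [⟨2, 2⟩, ⟨2, 3⟩, ⟨2, 4⟩, ⟨3, 4⟩], 8⟩,
   ⟨⟨6, 9⟩, [⟨2, 2⟩, ⟨2, 4⟩, ⟨2, 4⟩, ⟨3, 4⟩], 9⟩,
   ⟨⟨6, 9⟩, [⟨1, 3⟩, ⟨2, 3⟩, ⟨3, 4⟩, ⟨3, 4⟩], 9⟩,
   ⟨⟨6, 10⟩, [⟨2, 3⟩, ⟨3, 3⟩, ⟨2, 4⟩, ⟨3, 5⟩], 9⟩,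
   ⟨⟨7, 10⟩, [⟨2, 3⟩, ⟨2, 4⟩, ⟨3, 4⟩, ⟨3, 5⟩], 9⟩,
   ⟨⟨6, 10⟩, [⟨1, 3⟩, ⟨3, 4⟩, ⟨3, 4⟩, ⟨3, 4⟩], 10⟩,
   ⟨⟨6, 11⟩, [⟨2, 3⟩, ⟨3, 4⟩, ⟨3, 4⟩, ⟨3, 5⟩], 10⟩,
   ⟨⟨7, 11⟩, [⟨3, 3⟩, ⟨2, 4⟩, ⟨3, 5⟩, ⟨3, 5⟩], 10⟩,
   ⟨⟨7, 11⟩, [⟨2, 4⟩, ⟨2, 4⟩, ⟨3, 4⟩, ⟨4, 5⟩], 10⟩,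
   ⟨⟨7, 12⟩, [⟨2, 4⟩, ⟨3, 4⟩, ⟨3, 5⟩, ⟨4, 5⟩], 10⟩,
   ⟨⟨7, 12⟩, [⟨3, 4⟩, ⟨3, 4⟩, ⟨3, 4⟩, ⟨3, 6⟩], 11⟩,
   ⟨⟨7, 12⟩, [⟨3, 3⟩, ⟨3, 5⟩, ⟨3, 5⟩, ⟨3, 5⟩], 11⟩,
   ⟨⟨8, 12⟩, [⟨2, 4⟩, ⟨3, 5⟩, ⟨3, 5⟩, ⟨4, 5⟩], 11⟩,
   ⟨⟨8, 12⟩, [⟨3, 4⟩, ⟨3, 4⟩, ⟨3, 5⟩, ⟨3, 6⟩], 11⟩,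
   ⟨⟨8, 13⟩, [⟨3, 4⟩, ⟨3, 5⟩, ⟨4, 5⟩, ⟨3, 6⟩], 11⟩,
   ⟨⟨9, 13⟩, [⟨3, 5⟩, ⟨3, 5⟩, ⟨3, 5⟩, ⟨4, 6⟩], 12⟩,
   ⟨⟨8, 14⟩, [⟨3, 5⟩, ⟨3, 5⟩, ⟨4, 5⟩, ⟨4, 6⟩], 12⟩,
   ⟨⟨9, 14⟩, [⟨3, 5⟩, ⟨4, 5⟩, ⟨3, 6⟩, ⟨4, 6⟩], 12⟩,
   ⟨⟨9, 15⟩, [⟨4, 5⟩, ⟨3, 6⟩, ⟨4, 6⟩, ⟨4, 6⟩], 13⟩,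
   ⟨⟨10, 15⟩, [⟨3, 6⟩, ⟨4, 6⟩, ⟨4, 6⟩, ⟨4, 6⟩], 14⟩,
   ⟨⟨9, 16⟩, [⟨4, 6⟩, ⟨4, 6⟩, ⟨4, 6⟩, ⟨4, 6⟩], 15⟩]

/-- The shapes of the normals of the 120 facets of the base 120-cell. -/
def wallTable : List (ZPhi × List ZPhi) :=
  [
   ⟨⟨0, 0⟩, [⟨0, 0⟩, ⟨0, 0⟩, ⟨0, 0⟩, ⟨1, 0⟩]⟩,
   ⟨⟨0, -1⟩, [⟨0, -1⟩, ⟨0, 0⟩, ⟨0, 0⟩, ⟨0, 0⟩]⟩,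
   ⟨⟨-1, -1⟩, [⟨0, -1⟩, ⟨0, -1⟩, ⟨0, 0⟩, ⟨0, 0⟩]⟩,
   ⟨⟨-1, -2⟩, [⟨-1, -1⟩, ⟨0, -1⟩, ⟨0, -1⟩, ⟨0, 0⟩]⟩,
   ⟨⟨-2, -3⟩, [⟨-1, -2⟩, ⟨-1, -1⟩, ⟨0, -1⟩, ⟨0, -1⟩]⟩,
   ⟨⟨-2, -4⟩, [⟨-1, -2⟩, ⟨-1, -2⟩, ⟨-1, -1⟩, ⟨0, -1⟩]⟩,
   ⟨⟨-3, -4⟩, [⟨-1, -2⟩, ⟨-1, -2⟩, ⟨-1, -2⟩, ⟨0, -1⟩]⟩,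
   ⟨⟨-3, -5⟩, [⟨-1, -3⟩, ⟨-1, -2⟩, ⟨-1, -2⟩, ⟨-1, -1⟩]⟩,
   ⟨⟨-3, -6⟩, [⟨-2, -3⟩, ⟨-1, -2⟩, ⟨-1, -2⟩, ⟨-1, -2⟩]⟩,
   ⟨⟨-4, -6⟩, [⟨-2, -3⟩, ⟨-1, -3⟩, ⟨-1, -2⟩, ⟨-1, -2⟩]⟩,
   ⟨⟨-4, -7⟩, [⟨-2, -3⟩, ⟨-2, -3⟩, ⟨-1, -3⟩, ⟨-1, -2⟩]⟩,
   ⟨⟨-5, -8⟩, [⟨-2, -4⟩, ⟨-2, -3⟩, ⟨-2, -3⟩, ⟨-1, -3⟩]⟩,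
   ⟨⟨-5, -9⟩, [⟨-2, -4⟩, ⟨-2, -4⟩, ⟨-2, -3⟩, ⟨-2, -3⟩]⟩,
   ⟨⟨-6, -9⟩, [⟨-2, -4⟩, ⟨-2, -4⟩, ⟨-2, -4⟩, ⟨-2, -3⟩]⟩,
   ⟨⟨-6, -10⟩, [⟨-3, -4⟩, ⟨-2, -4⟩, ⟨-2, -4⟩, ⟨-2, -4⟩]⟩]

/-- The shapes of the vertices of the base 120-cell. -/
def vertexShapes : List Shape := vertexTable.map fun r => (r.1, (r.2.1 : Multiset ZPhi))

/-- The shapes of the facet normals of the base 120-cell. -/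
def wallShapes : List Shape := wallTable.map fun r => (r.1, (r.2 : Multiset ZPhi))

/-- The distance listed in `vertexTable`; shapes outside the table get the value `0`. -/
def Shape.depth (t : Shape) : ℕ :=
  ((vertexTable.find? fun r => r.1 = t.1 ∧ (r.2.1 : Multiset ZPhi) = t.2).map fun r => r.2.2).getD 0

theorem vertexShapes_move : ∀ t ∈ vertexShapes, ∀ m ∈ t.2, t.move m ∈ vertexShapes ∧
    (t.move m).depth ≤ t.depth + 1 := by
  decide +kernel

theorem wallShapes_move : ∀ t ∈ wallShapes, ∀ m ∈ t.2, t.move m ∈ wallShapes := by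
  decide +kernel

theorem vertexShapes_nonneg : ∀ t ∈ vertexShapes, ∀ m ∈ t.2, 0 ≤ m.re ∧ 0 ≤ m.im := by
  decide +kernel

theorem eq_of_depth_eq_zero : ∀ t ∈ vertexShapes, t.depth = 0 → t = (1, Multiset.replicate 4 0) := by
  decide +kernel

theorem exists_move_depth_lt : ∀ t ∈ vertexShapes, t.depth ≠ 0 →
    ¬ ∀ m ∈ t.2, t.depth ≤ (t.move m).depth := by
  decide +kernel

/-- A vertex on the wall of `axis 4` is no closer to the upper neighbour of the base vertex than to
the base vertex itself: facets of the 120-cell are strongly geodesically convex. -/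
theorem depth_le_move_zero : ∀ t ∈ vertexShapes, 0 ∈ t.2 → t.depth ≤ (t.move 0).depth := by
  decide +kernel

/-- The finite check behind `depth_le_of_wall_vec`. A facet normal whose shape is listed in
`wallTable` is matched against a vertex in every possible order of its space coordinates. -/
theorem depth_le_of_wall : ∀ r ∈ vertexTable, ∀ n ∈ wallTable, n.1 ≠ 0 → ∀ l ∈ n.2.permutations',
    - (r.1 * n.1) + phi * ((r.2.1.zip l).map fun q => q.1 * q.2).sum = 0 →
    ∀ q ∈ r.2.1.zip l, q.2 = 0 → q.1 ≠ 0 →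
      r.2.2 ≤ (Shape.move (phi * r.1 + n.1,
        ((r.2.1.zip l).map fun q => phi * q.1 + q.2 : Multiset ZPhi)) (phi * q.1)).depth + 1 := by
  decide +kernel

theorem depth_table : ∀ r ∈ vertexTable, Shape.depth (r.1, (r.2.1 : Multiset ZPhi)) = r.2.2 := by
  decide +kernel

/-! ### The golden ring and its two real embeddings -/

namespace ZPhi

/-- The embedding of `ℤ[φ]` in `ℝ` that sends `phi` to `φ`. -/
noncomputable def toReal : ZPhi →+* ℝ where
  toFun z := z.re + z.im * Real.goldenRatio
  map_zero' := by simp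
  map_one' := by simp [QuadraticAlgebra.re_one, QuadraticAlgebra.im_one]
  map_add' x y := by simp; ring
  map_mul' x y := by
    have h := Real.goldenRatio_sq
    simp
    linear_combination (-(x.im * y.im : ℝ)) * h

/-- The embedding of `ℤ[φ]` in `ℝ` that sends `phi` to the conjugate `-1/φ`. -/
noncomputable def toRealConj : ZPhi →+* ℝ where
  toFun z := z.re + z.im * Real.goldenConj
  map_zero' := by simp
  map_one' := by simp [QuadraticAlgebra.re_one, QuadraticAlgebra.im_one]
  map_add' x y := by simp; ring
  map_mul' x y := by
    have h := Real.goldenConj_sq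
    simp
    linear_combination (-(x.im * y.im : ℝ)) * h

theorem toReal_apply (z : ZPhi) : toReal z = z.re + z.im * Real.goldenRatio := rfl

theorem toRealConj_apply (z : ZPhi) : toRealConj z = z.re + z.im * Real.goldenConj := rfl

theorem toReal_phi : toReal phi = Real.goldenRatio := by simp [toReal_apply, phi]

theorem toRealConj_phi : toRealConj phi = Real.goldenConj := by simp [toRealConj_apply, phi]

theorem toReal_injective : Function.Injective toReal := by
  rw [injective_iff_map_eq_zero]
  intro z hz
  rw [toReal_apply] at hz
  have him : z.im = 0 := by
    by_contra h
    exact ((Real.goldenRatio_irrational.intCast_mul h).intCast_add z.re).ne_zero hz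
  have hre : z.re = 0 := by simpa [him] using hz
  exact QuadraticAlgebra.ext hre him

theorem toReal_mul_toRealConj (z : ZPhi) :
    toReal z * toRealConj z = ((z.re ^ 2 + z.re * z.im - z.im ^ 2 : ℤ) : ℝ) := by
  rw [toReal_apply, toRealConj_apply]
  push_cast
  linear_combination (z.re * z.im : ℝ) * Real.goldenRatio_add_goldenConj +
    (z.im ^ 2 : ℝ) * Real.goldenRatio_mul_goldenConj

theorem toRealConj_ne_zero {z : ZPhi} (hz : z ≠ 0) : toRealConj z ≠ 0 := by
  intro h
  rw [toRealConj_apply] at h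
  apply hz
  have him : z.im = 0 := by
    by_contra h'
    exact ((Real.goldenConj_irrational.intCast_mul h').intCast_add z.re).ne_zero h
  have hre : z.re = 0 := by simpa [him] using h
  exact QuadraticAlgebra.ext hre him

/-- The norm of a nonzero element of `ℤ[φ]` is a nonzero integer. -/
theorem one_le_abs_norm {z : ZPhi} (hz : z ≠ 0) : 1 ≤ |toReal z * toRealConj z| := by
  have h0 : toReal z * toRealConj z ≠ 0 :=
    mul_ne_zero ((map_ne_zero_iff _ toReal_injective).2 hz) (toRealConj_ne_zero hz)
  rw [toReal_mul_toRealConj] at h0 ⊢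
  rw [← Int.cast_abs]
  exact_mod_cast Int.one_le_abs (by exact_mod_cast h0)

theorem one_le_sq_mul_sq {z : ZPhi} (hz : z ≠ 0) : 1 ≤ toReal z ^ 2 * toRealConj z ^ 2 := by
  rw [← mul_pow, ← sq_abs]
  nlinarith [one_le_abs_norm hz]

instance : IsDomain ZPhi := toReal_injective.isDomain toReal

end ZPhi

/-! ### The action on integral vectors -/

/-- Vectors in the coordinates `(√φ x₀, x₁, …, x₄)` up to scaling (see `rescale`), in which the group
acts by matrices over `ℤ[φ]`. -/
abbrev Vec : Type := Fin 5 → ZPhi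

/-- `φ` times the Lorentzian form in the rescaled coordinates. The conjugate of this form is
definite. -/
def form (v w : Vec) : ZPhi :=
  -(v 0 * w 0) + phi * (v 1 * w 1 + v 2 * w 2 + v 3 * w 3 + v 4 * w 4)

/-- The reflections `r₀, …, r₄` in the rescaled coordinates. -/
def intReflMatrix : Fin 5 → Matrix (Fin 5) (Fin 5) ZPhi :=
  ![!![1, 0, 0, 0, 0;
       0, -1, 0, 0, 0;
       0, 0, 1, 0, 0;
       0, 0, 0, 1, 0;
       0, 0, 0, 0, 1],
    !![1, 0, 0, 0, 0;
       0, 0, 1, 0, 0;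
       0, 1, 0, 0, 0;
       0, 0, 0, 1, 0;
       0, 0, 0, 0, 1],
    !![1, 0, 0, 0, 0;
       0, 1, 0, 0, 0;
       0, 0, 0, 1, 0;
       0, 0, 1, 0, 0;
       0, 0, 0, 0, 1],
    !![1, 0, 0, 0, 0;
       0, 1, 0, 0, 0;
       0, 0, 1, 0, 0;
       0, 0, 0, 0, 1;
       0, 0, 0, 1, 0],
    !![phi, 0, 0, 0, -phi;
       0, 1, 0, 0, 0;
       0, 0, 1, 0, 0;
       0, 0, 0, 1, 0;
       1, 0, 0, 0, -phi]]

theorem intReflMatrix_mul_self (i : Fin 5) : intReflMatrix i * intReflMatrix i = 1 := by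
  revert i
  decide +kernel

/-- The reflections `r₀, …, r₄` as invertible matrices over `ℤ[φ]`. -/
def intRefl (i : Fin 5) : GL (Fin 5) ZPhi :=
  ⟨intReflMatrix i, intReflMatrix i, intReflMatrix_mul_self i, intReflMatrix_mul_self i⟩

theorem sqrt_goldenRatio_mul_self : √Real.goldenRatio * √Real.goldenRatio = Real.goldenRatio :=
  Real.mul_self_sqrt Real.goldenRatio_pos.le

theorem sqrt_goldenRatio_ne_zero : √Real.goldenRatio ≠ 0 :=
  (Real.sqrt_pos.2 Real.goldenRatio_pos).ne'

/-- The change of coordinates `x ↦ √φ • x` on the space coordinates, which removes `√φ` from the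
matrix of `r₄`. -/
noncomputable def rescale : GL (Fin 5) ℝ :=
  ⟨diagonal ![1, √Real.goldenRatio, √Real.goldenRatio, √Real.goldenRatio, √Real.goldenRatio],
   diagonal ![1, (√Real.goldenRatio)⁻¹, (√Real.goldenRatio)⁻¹, (√Real.goldenRatio)⁻¹,
     (√Real.goldenRatio)⁻¹], by
    have h := sqrt_goldenRatio_ne_zero
    generalize √Real.goldenRatio = s at h ⊢
    rw [diagonal_mul_diagonal, ← diagonal_one]
    congr 1
    funext i
    fin_cases i <;> simp [h], by
    have h := sqrt_goldenRatio_ne_zero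
    generalize √Real.goldenRatio = s at h ⊢
    rw [diagonal_mul_diagonal, ← diagonal_one]
    congr 1
    funext i
    fin_cases i <;> simp [h]⟩

/-- Matrices over `ℤ[φ]` as real matrices in the original coordinates. -/
noncomputable def toRealGL : GL (Fin 5) ZPhi →* GL (Fin 5) ℝ :=
  (MulAut.conj rescale).toMonoidHom.comp (GeneralLinearGroup.map toReal)

theorem toRealGL_injective : Function.Injective toRealGL := by
  refine (MulAut.conj rescale).injective.comp ?_
  intro A B h
  refine Units.ext (Matrix.ext fun i j => toReal_injective ?_)
  exact congrArg (fun C : GL (Fin 5) ℝ => (C : Matrix (Fin 5) (Fin 5) ℝ) i j) h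

theorem toRealGL_intRefl (i : Fin 5) : toRealGL (intRefl i) = wallRefl i := by
  have h : rescale * GeneralLinearGroup.map toReal (intRefl i) = wallRefl i * rescale := by
    ext a b
    have h1 := sqrt_goldenRatio_mul_self
    have h2 := toReal_phi
    simp only [rescale, intRefl, wallRefl, intReflMatrix, reflMatrix, Units.val_mul,
      GeneralLinearGroup.map_apply, diagonal_mul]
    generalize √Real.goldenRatio = s at h1 ⊢
    generalize Real.goldenRatio = t at h1 h2 ⊢
    fin_cases i <;> fin_cases a <;> fin_cases b <;>
      simp [Matrix.mul_apply, Fin.sum_univ_five, h2] <;> linarith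
  exact mul_inv_eq_of_eq_mul h

theorem Gam_le_range : Gam ≤ toRealGL.range := by
  rw [Gam, Subgroup.closure_le]
  rintro _ ⟨i, rfl⟩
  exact ⟨intRefl i, toRealGL_intRefl i⟩

/-- The matrix over `ℤ[φ]` of an element of `Gam` in the rescaled coordinates. -/
noncomputable def intMatrix : Gam →* GL (Fin 5) ZPhi :=
  (MonoidHom.ofInjective toRealGL_injective).symm.toMonoidHom.comp (Subgroup.inclusion Gam_le_range)

theorem toRealGL_intMatrix (g : Gam) : toRealGL (intMatrix g) = g := by
  exact MonoidHom.apply_ofInjective_symm toRealGL_injective (Subgroup.inclusion Gam_le_range g)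

theorem intMatrix_injective : Function.Injective intMatrix := by
  intro g h e
  exact Subtype.ext (by rw [← toRealGL_intMatrix, ← toRealGL_intMatrix, e])

/-- The generating reflections as elements of `Gam`. -/
noncomputable def gen (i : Fin 5) : Gam := ⟨wallRefl i, Subgroup.subset_closure ⟨i, rfl⟩⟩

theorem intMatrix_gen (i : Fin 5) : intMatrix (gen i) = intRefl i :=
  toRealGL_injective ((toRealGL_intMatrix _).trans (toRealGL_intRefl i).symm)

/-- The action of `Gam` on integral vectors. -/
noncomputable def act (g : Gam) (v : Vec) : Vec := (intMatrix g : Matrix (Fin 5) (Fin 5) ZPhi) *ᵥ v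

theorem act_one (v : Vec) : act 1 v = v := by simp [act]

theorem act_mul (g h : Gam) (v : Vec) : act (g * h) v = act g (act h v) := by
  simp [act, mulVec_mulVec]

theorem act_inv_act (g : Gam) (v : Vec) : act g⁻¹ (act g v) = v := by
  rw [← act_mul, inv_mul_cancel, act_one]

theorem act_act_inv (g : Gam) (v : Vec) : act g (act g⁻¹ v) = v := by
  rw [← act_mul, mul_inv_cancel, act_one]

theorem act_add (g : Gam) (v w : Vec) : act g (v + w) = act g v + act g w := mulVec_add ..

theorem act_neg (g : Gam) (v : Vec) : act g (-v) = -act g v := mulVec_neg ..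

theorem act_smul (g : Gam) (a : ZPhi) (v : Vec) : act g (a • v) = a • act g v := mulVec_smul ..

/-- The reflections `r₀, …, r₄` as explicit maps of vectors, a form in which they can be evaluated. -/
def reflVec (i : Fin 5) (v : Vec) : Vec :=
  ![![v 0, -v 1, v 2, v 3, v 4],
    ![v 0, v 2, v 1, v 3, v 4],
    ![v 0, v 1, v 3, v 2, v 4],
    ![v 0, v 1, v 2, v 4, v 3],
    ![phi * (v 0 - v 4), v 1, v 2, v 3, v 0 - phi * v 4]] i

theorem act_gen (i : Fin 5) (v : Vec) : act (gen i) v = reflVec i v := by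
  rw [act, intMatrix_gen]
  funext j
  fin_cases i <;> fin_cases j <;>
    simp [intRefl, intReflMatrix, reflVec, mulVec, dotProduct, Fin.sum_univ_five] <;> ring

theorem gen_mul_self (i : Fin 5) : gen i * gen i = 1 :=
  Subtype.ext (Units.ext (reflMatrix_mul_self i))

theorem gen_inv (i : Fin 5) : (gen i)⁻¹ = gen i := inv_eq_of_mul_eq_one_left (gen_mul_self i)

theorem gen_mem_faceSubgroup {i j : Fin 5} (h : j ≠ i) : gen j ∈ faceSubgroup i :=
  Subgroup.subset_closure ⟨j, h, rfl⟩

theorem faceSubgroup_induction {i : Fin 5} {p : Gam → Prop} (one : p 1)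
    (mul : ∀ j, j ≠ i → ∀ g, p g → p (gen j * g)) {g : Gam} (hg : g ∈ faceSubgroup i) : p g := by
  induction hg using Subgroup.closure_induction_left with
  | one => exact one
  | mul_left x hx y _ hy =>
    obtain ⟨j, hj, e⟩ := hx
    obtain rfl : x = gen j := Subtype.ext e
    exact mul j hj y hy
  | inv_mul_cancel x hx y _ hy =>
    obtain ⟨j, hj, e⟩ := hx
    obtain rfl : x = gen j := Subtype.ext e
    rw [gen_inv]
    exact mul j hj y hy

theorem Gam_induction {p : Gam → Prop} (one : p 1) (mul : ∀ j g, p g → p (gen j * g)) (g : Gam) :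
    p g := by
  obtain ⟨g, hg⟩ := g
  induction hg using Subgroup.closure_induction_left with
  | one => exact one
  | mul_left x hx y hy' hy =>
    obtain ⟨j, rfl⟩ := hx
    exact mul j _ hy
  | inv_mul_cancel x hx y hy' hy =>
    obtain ⟨j, rfl⟩ := hx
    exact mul j _ hy

theorem form_reflVec (i : Fin 5) (v w : Vec) : form (reflVec i v) (reflVec i w) = form v w := by
  have h : phi * phi = phi + 1 := by decide
  fin_cases i <;> simp [form, reflVec, -mul_eq_mul_left_iff]
  · ring
  · ring
  · ring
  · linear_combination (-(v 0 * w 0) + (v 4 * w 4) * phi) * h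

theorem form_act (g : Gam) : ∀ v w, form (act g v) (act g w) = form v w := by
  induction g using Gam_induction with
  | one => simp [act_one]
  | mul j g ih => intro v w; rw [act_mul, act_mul, act_gen, act_gen, form_reflVec, ih]

/-! ### Walls -/

/-- The coordinate vectors. `axis 0` represents the base vertex of `{5,3,3,4}`, and
`axis 1, …, axis 4` are the normals of the four walls through it. -/
def axis (i : Fin 5) : Vec := Pi.single i 1

/-- The walls of `{5,3,3,4}`, the hyperplanes tiled by its 3-faces, are given by normal vectors with
entries in `ℤ[φ]` and Lorentzian norm `1`. Only these two properties of the normals matter. -/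
def IsWall (w : Vec) : Prop := form w w = phi

theorem form_neg_left (v w : Vec) : form (-v) w = -form v w := by simp [form]; ring

theorem form_neg_right (v w : Vec) : form v (-w) = -form v w := by simp [form]; ring

theorem form_comm (v w : Vec) : form v w = form w v := by simp only [form]; ring

theorem form_add_right (u v w : Vec) : form u (v + w) = form u v + form u w := by
  simp only [form, Pi.add_apply]; ring

theorem form_smul_right (u : Vec) (a : ZPhi) (v : Vec) : form u (a • v) = a * form u v := by
  simp only [form, Pi.smul_apply, smul_eq_mul]; ring

theorem form_act_left (g : Gam) (v w : Vec) : form (act g v) w = form v (act g⁻¹ w) := by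
  rw [← form_act g v, act_act_inv]

theorem form_axis_zero (w : Vec) : form w (axis 0) = -w 0 := by simp [form, axis]

theorem form_axis {i : Fin 5} (hi : i ≠ 0) (w : Vec) : form w (axis i) = phi * w i := by
  fin_cases i <;> simp_all [form, axis]

theorem IsWall.neg {w : Vec} (hw : IsWall w) : IsWall (-w) := by
  rw [IsWall, form_neg_left, form_neg_right, neg_neg, hw]

theorem IsWall.act {w : Vec} (hw : IsWall w) (g : Gam) : IsWall (act g w) := by
  rw [IsWall, form_act, hw]

theorem isWall_axis {i : Fin 5} (hi : i ≠ 0) : IsWall (axis i) := by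
  rw [IsWall, form_axis hi]; simp [axis]

theorem reflVec_four_axis_zero : reflVec 4 (axis 0) = phi • axis 0 + axis 4 := by decide

theorem reflVec_four_axis_four : reflVec 4 (axis 4) = -(phi • axis 0 + phi • axis 4) := by decide

theorem IsWall.real_eq {w : Vec} (hw : IsWall w) : -toReal (w 0) ^ 2 +
    Real.goldenRatio * (toReal (w 1) ^ 2 + toReal (w 2) ^ 2 + toReal (w 3) ^ 2 + toReal (w 4) ^ 2)
      = Real.goldenRatio := by
  have h := congrArg toReal hw
  simp only [form, map_add, map_neg, map_mul, toReal_phi] at h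
  linear_combination h

/-- The conjugate form is definite, so that the conjugate coordinates of a wall are bounded. -/
theorem IsWall.conj_eq {w : Vec} (hw : IsWall w) :
    Real.goldenRatio * toRealConj (w 0) ^ 2 + (toRealConj (w 1) ^ 2 + toRealConj (w 2) ^ 2 +
      toRealConj (w 3) ^ 2 + toRealConj (w 4) ^ 2) = 1 := by
  have h := congrArg toRealConj hw
  simp only [form, map_add, map_neg, map_mul, toRealConj_phi] at h
  have h2 := Real.goldenRatio_mul_goldenConj
  linear_combination (-Real.goldenRatio) * h + (toRealConj (w 1) ^ 2 + toRealConj (w 2) ^ 2 +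
      toRealConj (w 3) ^ 2 + toRealConj (w 4) ^ 2 - 1) * h2

theorem eq_one_or_neg_one {z : ZPhi} (hz : z ≠ 0) (h1 : toReal z ^ 2 ≤ 1)
    (h2 : toRealConj z ^ 2 ≤ 1) : toReal z ^ 2 = 1 ∧ (z = 1 ∨ z = -1) := by
  have h := one_le_sq_mul_sq hz
  have h3 : toReal z ^ 2 = 1 := by nlinarith [sq_nonneg (toReal z), sq_nonneg (toRealConj z)]
  refine ⟨h3, ?_⟩
  rw [sq, mul_self_eq_one_iff] at h3
  exact h3.imp (fun h => toReal_injective (by rw [h, map_one]))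
    fun h => toReal_injective (by rw [h, map_neg, map_one])

/-- The only walls through the base vertex are the coordinate hyperplanes. -/
theorem IsWall.eq_axis {w : Vec} (hw : IsWall w) (h0 : w 0 = 0) :
    ∃ i, i ≠ 0 ∧ (w = axis i ∨ w = -axis i) := by
  have hr : ∑ i : Fin 4, toReal (w i.succ) ^ 2 = 1 := by
    refine mul_left_cancel₀ Real.goldenRatio_pos.ne' ?_
    simpa [h0, Fin.sum_univ_four] using hw.real_eq
  have hc : ∑ i : Fin 4, toRealConj (w i.succ) ^ 2 = 1 := by
    simpa [h0, Fin.sum_univ_four] using hw.conj_eq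
  obtain ⟨i, hi⟩ : ∃ i : Fin 4, w i.succ ≠ 0 := by
    by_contra! h
    simp [h] at hr
  obtain ⟨h, h'⟩ := eq_one_or_neg_one hi
    (hr ▸ Finset.single_le_sum (f := fun i : Fin 4 => toReal (w i.succ) ^ 2)
      (fun _ _ => sq_nonneg _) (Finset.mem_univ i))
    (hc ▸ Finset.single_le_sum (f := fun i : Fin 4 => toRealConj (w i.succ) ^ 2)
      (fun _ _ => sq_nonneg _) (Finset.mem_univ i))
  have hz : ∀ j : Fin 5, j ≠ i.succ → w j = 0 := by
    intro j hj
    rcases Fin.eq_zero_or_eq_succ j with rfl | ⟨j, rfl⟩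
    · exact h0
    · have h2 := Finset.add_le_sum (f := fun i : Fin 4 => toReal (w i.succ) ^ 2)
        (fun _ _ => sq_nonneg _) (Finset.mem_univ i) (Finset.mem_univ j) (by rintro rfl; exact hj rfl)
      simp only [hr, h] at h2
      have h3 : toReal (w j.succ) ^ 2 = 0 := le_antisymm (by linarith) (sq_nonneg _)
      exact toReal_injective (((pow_eq_zero_iff two_ne_zero).1 h3).trans (map_zero _).symm)
  refine ⟨i.succ, Fin.succ_ne_zero i, h'.imp ?_ ?_⟩ <;>
  · intro h
    funext j
    rcases eq_or_ne j i.succ with rfl | hne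
    · simp [axis, h]
    · simp [axis, hne, hz j hne]

/-- A wall does not cross the edge from `axis 0` to `phi • axis 0 + axis 4`: otherwise the nonzero
element `w 0 * (w 0 - w 4)` of `ℤ[φ]` has norm less than `1`. -/
theorem IsWall.not_cross_edge {w : Vec} (hw : IsWall w) (h0 : 0 < toReal (form w (axis 0)))
    (h1 : toReal (form w (phi • axis 0 + axis 4)) < 0) : False := by
  have hr := hw.real_eq
  have hc := hw.conj_eq
  have hp := Real.one_lt_goldenRatio
  rw [form_axis_zero, map_neg] at h0
  rw [form_add_right, form_smul_right, form_axis_zero, form_axis (by decide), map_add, map_mul,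
    map_mul, toReal_phi, map_neg] at h1
  have h2 : toReal (w 4) < toReal (w 0) := by nlinarith
  have hne : w 0 * (w 0 - w 4) ≠ 0 := by
    refine mul_ne_zero (fun h => ?_) (fun h => ?_)
    · simp [h] at h0
    · rw [sub_eq_zero.1 h] at h2; exact lt_irrefl _ h2
  have hn := one_le_abs_norm hne
  rw [abs_mul] at hn
  simp only [map_mul, map_sub] at hn
  generalize toReal (w 0) = x at *
  generalize toReal (w 4) = y at *
  generalize toRealConj (w 0) = x' at *
  generalize toRealConj (w 4) = y' at *
  generalize Real.goldenRatio = t at *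
  have s1 := sq_nonneg (toReal (w 1))
  have s2 := sq_nonneg (toReal (w 2))
  have s3 := sq_nonneg (toReal (w 3))
  have c1 := sq_nonneg (toRealConj (w 1))
  have c2 := sq_nonneg (toRealConj (w 2))
  have c3 := sq_nonneg (toRealConj (w 3))
  have hy : t * y ^ 2 ≤ t + x ^ 2 := by nlinarith
  have hy' : y ^ 2 - x ^ 2 ≤ 1 := by
    by_contra hcon
    push Not at hcon
    nlinarith [sq_nonneg x]
  have hA : |x * (x - y)| ≤ 1 / 2 := by
    rw [abs_le]; constructor <;> nlinarith
  have hB : |x' * (x' - y')| < 2 := by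
    rw [abs_lt]; constructor <;> nlinarith [sq_nonneg (x' - y'), sq_nonneg (x' + y'), sq_nonneg x']
  nlinarith [abs_nonneg (x * (x - y)), abs_nonneg (x' * (x' - y'))]

/-- The reversed Cauchy–Schwarz inequality, for a causal vector `w` and a timelike vector `b`. -/
theorem timelike_mul_lt {t w0 w1 w2 w3 b0 b1 b2 b3 : ℝ} (ht : 0 < t) (hw0 : 0 < w0) (hb0 : 0 < b0)
    (hw : t * (w1 ^ 2 + w2 ^ 2 + w3 ^ 2) ≤ w0 ^ 2) (hb : t * (b1 ^ 2 + b2 ^ 2 + b3 ^ 2) < b0 ^ 2) :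
    t * (w1 * b1 + w2 * b2 + w3 * b3) < w0 * b0 := by
  have hcs : (w1 * b1 + w2 * b2 + w3 * b3) ^ 2 ≤
      (w1 ^ 2 + w2 ^ 2 + w3 ^ 2) * (b1 ^ 2 + b2 ^ 2 + b3 ^ 2) := by
    nlinarith [sq_nonneg (w1 * b2 - w2 * b1), sq_nonneg (w1 * b3 - w3 * b1),
      sq_nonneg (w2 * b3 - w3 * b2)]
  refine lt_of_pow_lt_pow_left₀ 2 (by positivity) ?_
  calc (t * (w1 * b1 + w2 * b2 + w3 * b3)) ^ 2
      = t ^ 2 * (w1 * b1 + w2 * b2 + w3 * b3) ^ 2 := by ring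
    _ ≤ t ^ 2 * ((w1 ^ 2 + w2 ^ 2 + w3 ^ 2) * (b1 ^ 2 + b2 ^ 2 + b3 ^ 2)) :=
        mul_le_mul_of_nonneg_left hcs (sq_nonneg t)
    _ = (t * (w1 ^ 2 + w2 ^ 2 + w3 ^ 2)) * (t * (b1 ^ 2 + b2 ^ 2 + b3 ^ 2)) := by ring
    _ ≤ w0 ^ 2 * (t * (b1 ^ 2 + b2 ^ 2 + b3 ^ 2)) :=
        mul_le_mul_of_nonneg_right hw (by positivity)
    _ < w0 ^ 2 * b0 ^ 2 := mul_lt_mul_of_pos_left hb (by positivity)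
    _ = (w0 * b0) ^ 2 := by ring

/-- A wall that is not perpendicular to the wall of `axis 4` misses it: by integrality `|w 4| ≥ 1`,
so that the projection of `w` to the hyperplane `b 4 = 0` is causal, and a causal vector does not
separate two points of the hyperboloid. -/
theorem IsWall.not_separate {w b : Vec} (hw : IsWall w) (h4 : w 4 ≠ 0) (hb : form b b = -1)
    (hb4 : b 4 = 0) (hb0 : 0 < toReal (b 0)) (h0 : toReal (form w (axis 0)) < 0)
    (h1 : 0 < toReal (form w b)) : False := by
  have hp := Real.goldenRatio_pos
  have c4 : toRealConj (w 4) ^ 2 ≤ 1 := by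
    have hc := hw.conj_eq
    have c0 := mul_nonneg hp.le (sq_nonneg (toRealConj (w 0)))
    linarith [sq_nonneg (toRealConj (w 1)), sq_nonneg (toRealConj (w 2)),
      sq_nonneg (toRealConj (w 3))]
  have r4 : 1 ≤ toReal (w 4) ^ 2 :=
    (one_le_sq_mul_sq h4).trans (mul_le_of_le_one_right (sq_nonneg _) c4)
  have hr := hw.real_eq
  have hb' := congrArg toReal hb
  rw [form_axis_zero, map_neg] at h0
  simp only [form, hb4, map_add, map_neg, map_mul, toReal_phi, map_zero, map_one] at h1 hb'
  have h := timelike_mul_lt (w1 := toReal (w 1)) (w2 := toReal (w 2)) (w3 := toReal (w 3))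
    (b1 := toReal (b 1)) (b2 := toReal (b 2)) (b3 := toReal (b 3)) hp (neg_lt_zero.1 h0) hb0
    (by linarith [mul_le_mul_of_nonneg_left r4 hp.le]) (by linarith)
  linarith

theorem form_act_axis_zero (g : Gam) : form (act g (axis 0)) (act g (axis 0)) = -1 := by
  rw [form_act, form_axis_zero]; simp [axis]

theorem toReal_act_axis_zero_pos (g : Gam) : 0 < toReal (act g (axis 0) 0) := by
  induction g using Gam_induction with
  | one => simp [act_one, axis]
  | mul j g ih =>
    have h := form_act_axis_zero g
    rw [act_mul, act_gen]
    generalize act g (axis 0) = v at *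
    have hp := Real.one_lt_goldenRatio
    have h' := congrArg toReal h
    simp only [form, map_add, map_neg, map_mul, toReal_phi, map_one] at h'
    fin_cases j <;> simp only [reflVec] <;> try exact ih
    simp only [Fin.reduceFinMk, cons_val, cons_val_zero, map_mul, map_sub, toReal_phi]
    have : toReal (v 4) < toReal (v 0) := by
      by_contra hcon
      push Not at hcon
      nlinarith [sq_nonneg (toReal (v 1)), sq_nonneg (toReal (v 2)), sq_nonneg (toReal (v 3))]
    nlinarith

/-! ### The stabilizer of the base vertex -/

/-- The product of a list of generators. -/
noncomputable def word (L : List (Fin 5)) : Gam := (L.map gen).prod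

theorem act_word (L : List (Fin 5)) (v : Vec) : act (word L) v = L.foldr reflVec v := by
  induction L with
  | nil => simp [word, act_one]
  | cons i L ih =>
    rw [List.foldr_cons, ← ih, ← act_gen, ← act_mul]
    simp [word]

theorem word_mem_faceSubgroup {i : Fin 5} {L : List (Fin 5)} (h : i ∉ L) :
    word L ∈ faceSubgroup i := by
  refine Subgroup.list_prod_mem _ ?_
  intro x hx
  obtain ⟨j, hj, rfl⟩ := List.mem_map.1 hx
  exact gen_mem_faceSubgroup fun e => h (e ▸ hj)

theorem act_axis_zero_of_mem {g : Gam} (hg : g ∈ faceSubgroup 4) : act g (axis 0) = axis 0 := by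
  refine faceSubgroup_induction (p := fun g => act g (axis 0) = axis 0) (act_one _)
    (fun j hj g ih => ?_) hg
  rw [act_mul, ih, act_gen]
  revert hj; revert j
  decide

/-- A word in `r₁, r₂, r₃` that moves `axis j` to `axis k` for `0 < j ≤ k`. -/
def carryWord (j k : Fin 5) : List (Fin 5) :=
  ([1, 2, 3].filter fun i => j ≤ i ∧ i < k).reverse

/-- A word in `r₀, …, r₃` for the reflection in the wall of `axis j`. -/
def flipWord (j : Fin 5) : List (Fin 5) :=
  carryWord 1 j ++ 0 :: (carryWord 1 j).reverse

theorem carryWord_spec : ∀ j k : Fin 5, j ≠ 0 → j ≤ k → 4 ∉ carryWord j k ∧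
    (carryWord j k).foldr reflVec (axis j) = axis k ∧
    ∀ m, k < m → (carryWord j k).foldr reflVec (axis m) = axis m := by
  decide +kernel

theorem flipWord_spec : ∀ j : Fin 5, j ≠ 0 → 4 ∉ flipWord j ∧
    (flipWord j).foldr reflVec (axis j) = -axis j ∧
    ∀ m, m ≠ j → (flipWord j).foldr reflVec (axis m) = axis m := by
  decide +kernel

theorem exists_carry {j k : Fin 5} (hj : j ≠ 0) (hjk : j ≤ k) {w : Vec}
    (hw : w = axis j ∨ w = -axis j) :
    ∃ b ∈ faceSubgroup 4, act b w = axis k ∧ ∀ m, k < m → act b (axis m) = axis m := by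
  obtain ⟨h1, h2, h3⟩ := carryWord_spec j k hj hjk
  rcases hw with rfl | rfl
  · exact ⟨word (carryWord j k), word_mem_faceSubgroup h1, by rw [act_word, h2],
      fun m hm => by rw [act_word, h3 m hm]⟩
  · obtain ⟨f1, f2, f3⟩ := flipWord_spec j hj
    refine ⟨word (carryWord j k) * word (flipWord j),
      mul_mem (word_mem_faceSubgroup h1) (word_mem_faceSubgroup f1), ?_, fun m hm => ?_⟩
    · rw [act_mul, act_neg, act_word (flipWord j), f2, neg_neg, act_word, h2]
    · rw [act_mul, act_word (flipWord j), f3 m (hjk.trans_lt hm).ne', act_word, h3 m hm]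

/-- A linear map is determined by its values on the axes. -/
theorem eq_one_of_act_axis {g : Gam} (h : ∀ i, act g (axis i) = axis i) : g = 1 := by
  apply intMatrix_injective
  rw [map_one]
  refine Units.ext (Matrix.ext fun i j => ?_)
  have := congrFun (h j) i
  simpa [act, axis, Matrix.one_apply, Pi.single_apply] using this

theorem form_axis_axis {i j : Fin 5} (hij : i ≠ j) : form (axis i) (axis j) = 0 := by
  revert i j; decide

/-- An element that fixes the base vertex is a signed permutation of the space coordinates, since it
permutes the walls through that vertex, and signed permutations are generated by `r₀, …, r₃`. Here
`axis 4, axis 3, …` are put back in place one after the other. -/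
theorem mem_faceSubgroup_four {g : Gam} (hg : act g (axis 0) = axis 0) : g ∈ faceSubgroup 4 := by
  suffices H : ∀ n : ℕ, n ≤ 4 → ∃ b ∈ faceSubgroup 4,
      ∀ m : Fin 5, 4 < m.val + n → act (b * g) (axis m) = axis m by
    obtain ⟨b, hb, h⟩ := H 4 le_rfl
    have h1 : b * g = 1 := by
      refine eq_one_of_act_axis fun i => ?_
      rcases eq_or_ne i 0 with rfl | hi
      · rw [act_mul, hg, act_axis_zero_of_mem hb]
      · exact h i (by have := Fin.pos_iff_ne_zero.2 hi; rw [Fin.lt_def] at this; simp at this; omega)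
    rw [eq_inv_of_mul_eq_one_right h1]
    exact inv_mem hb
  intro n
  induction n with
  | zero => exact fun _ => ⟨1, one_mem _, fun m hm => by omega⟩
  | succ n ih =>
    intro hn
    obtain ⟨b, hb, h⟩ := ih (by omega)
    let k : Fin 5 := ⟨4 - n, by omega⟩
    have hk : k ≠ 0 := by simp only [k, ne_eq, Fin.ext_iff]; simp; omega
    have hb0 : act (b * g) (axis 0) = axis 0 := by rw [act_mul, hg, act_axis_zero_of_mem hb]
    have hw : IsWall (act (b * g) (axis k)) := (isWall_axis hk).act _
    have hw0 : act (b * g) (axis k) 0 = 0 := by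
      have h1 := form_act (b * g) (axis k) (axis 0)
      rw [hb0, form_axis_zero, form_axis_axis hk] at h1
      exact neg_eq_zero.1 h1
    obtain ⟨j, hj, hj'⟩ := hw.eq_axis hw0
    have hjk : j ≤ k := by
      by_contra hlt
      have h2 : act (b * g) (axis j) = axis j :=
        h j (by rw [not_le, Fin.lt_def] at hlt; simp only [k] at hlt; omega)
      have h1 := form_act (b * g) (axis k) (axis j)
      rw [h2, form_axis_axis (fun e => hlt e.ge)] at h1
      rcases hj' with e | e <;> rw [e] at h1
      · rw [form_axis hj] at h1
        simp [axis] at h1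
        exact absurd h1 (by decide)
      · rw [form_neg_left, form_axis hj] at h1
        simp [axis] at h1
        exact absurd h1 (by decide)
    obtain ⟨b', hb', h1, h2⟩ := exists_carry hj hjk hj'
    refine ⟨b' * b, mul_mem hb' hb, fun m hm => ?_⟩
    rw [mul_assoc, act_mul]
    rcases eq_or_ne m k with rfl | hmk
    · exact h1
    · have hm' : 4 - n ≠ m.val := fun e => hmk (Fin.ext e.symm)
      rw [h m (by omega), h2 m (by rw [Fin.lt_def]; simp only [k]; omega)]

theorem mem_faceSubgroup_four_iff {g : Gam} : g ∈ faceSubgroup 4 ↔ act g (axis 0) = axis 0 :=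
  ⟨act_axis_zero_of_mem, mem_faceSubgroup_four⟩

/-- A word for the simultaneous change of sign of the coordinates selected by `ε`. -/
def signWord (ε : Fin 5 → Bool) : List (Fin 5) :=
  ([1, 2, 3, 4] : List (Fin 5)).flatMap fun j => if ε j then flipWord j else []

theorem signWord_spec : ∀ ε : Fin 5 → Bool, 4 ∉ signWord ε ∧ ∀ j, j ≠ 0 →
    (signWord ε).foldr reflVec (axis j) = if ε j then -axis j else axis j := by
  decide +kernel

/-! ### Vertices, edges and cells -/

/-- The vertex of `{5,3,3,4}` of the chamber `g`. -/
def vtx (g : Gam) : Face 0 := (QuotientGroup.mk g : CubeFace 4)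

/-- The edge of `{5,3,3,4}` of the chamber `g`. -/
def edge (g : Gam) : Face 1 := (QuotientGroup.mk g : CubeFace 3)

/-- The 120-cell of the chamber `g`. -/
def cell (g : Gam) : Face 4 := (QuotientGroup.mk g : CubeFace 0)

theorem exists_vtx (v : Face 0) : ∃ g, vtx g = v :=
  QuotientGroup.mk_surjective (s := faceSubgroup 4) v

theorem vtx_eq_iff_mem {g h : Gam} : vtx g = vtx h ↔ g⁻¹ * h ∈ faceSubgroup 4 :=
  QuotientGroup.eq (s := faceSubgroup 4)

theorem vtx_eq_iff {g h : Gam} : vtx g = vtx h ↔ act g (axis 0) = act h (axis 0) := by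
  rw [vtx_eq_iff_mem, mem_faceSubgroup_four_iff, act_mul]
  constructor <;> intro e
  · rw [← act_act_inv g (act h (axis 0)), e]
  · rw [← e, act_inv_act]

theorem vtx_mul {g b : Gam} (hb : b ∈ faceSubgroup 4) : vtx (g * b) = vtx g :=
  (vtx_eq_iff_mem.2 (by simpa using hb)).symm

theorem edge_mul {g b : Gam} (hb : b ∈ faceSubgroup 3) : edge (g * b) = edge g :=
  (QuotientGroup.eq (s := faceSubgroup 3).2 (by simpa using hb)).symm

theorem cell_mul {g b : Gam} (hb : b ∈ faceSubgroup 0) : cell (g * b) = cell g :=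
  (QuotientGroup.eq (s := faceSubgroup 0).2 (by simpa using hb)).symm

theorem incident_vtx_edge (g : Gam) : Incident (vtx g) (edge g) := ⟨g, rfl, rfl⟩

theorem incident_vtx_cell (g : Gam) : Incident (vtx g) (cell g) := ⟨g, rfl, rfl⟩

theorem incident_edge_cell (g : Gam) : Incident (edge g) (cell g) := ⟨g, rfl, rfl⟩

theorem edge_eq_iff_mem {g h : Gam} : edge g = edge h ↔ g⁻¹ * h ∈ faceSubgroup 3 :=
  QuotientGroup.eq (s := faceSubgroup 3)

theorem skeleton_adj_step (g : Gam) : skeleton.Adj (vtx g) (vtx (g * gen 4)) := by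
  refine ⟨fun h => ?_, edge g, incident_vtx_edge g, ?_⟩
  · rw [vtx_eq_iff_mem, inv_mul_cancel_left, mem_faceSubgroup_four_iff, act_gen] at h
    exact absurd h (by decide)
  · rw [← edge_mul (g := g) (gen_mem_faceSubgroup (i := 3) (j := 4) (by decide))]
    exact incident_vtx_edge _

theorem gen_commute_four {j : Fin 5} (h3 : j ≠ 3) : Commute (gen 4) (gen j) := by
  have : intMatrix (gen 4) * intMatrix (gen j) = intMatrix (gen j) * intMatrix (gen 4) := by
    rw [intMatrix_gen, intMatrix_gen]
    refine Units.ext ?_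
    change intReflMatrix 4 * intReflMatrix j = intReflMatrix j * intReflMatrix 4
    revert h3; revert j
    decide +kernel
  exact intMatrix_injective (by rw [map_mul, map_mul, this])

theorem mem_or_mem_of_mem_faceSubgroup_three {g : Gam} (hg : g ∈ faceSubgroup 3) :
    ∃ b ∈ faceSubgroup 4, g = b ∨ g = gen 4 * b := by
  refine faceSubgroup_induction (p := fun g => ∃ b ∈ faceSubgroup 4, g = b ∨ g = gen 4 * b)
    ⟨1, one_mem _, .inl rfl⟩ ?_ hg
  rintro j hj g ⟨b, hb, h⟩
  rcases eq_or_ne j 4 with rfl | h4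
  · rcases h with rfl | rfl
    · exact ⟨_, hb, .inr rfl⟩
    · exact ⟨_, hb, .inl (by rw [← mul_assoc, gen_mul_self, one_mul])⟩
  · refine ⟨gen j * b, mul_mem (gen_mem_faceSubgroup h4) hb, ?_⟩
    rcases h with rfl | rfl
    · exact .inl rfl
    · exact .inr (by rw [← mul_assoc, ← (gen_commute_four hj).eq, mul_assoc])

theorem exists_of_skeleton_adj {v w : Face 0} (h : skeleton.Adj v w) :
    ∃ g, v = vtx g ∧ w = vtx (g * gen 4) := by
  obtain ⟨hne, e, ⟨g, rfl, hg⟩, ⟨g', rfl, hg'⟩⟩ := h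
  have he : edge g = edge g' := hg.trans hg'.symm
  obtain ⟨b, hb, h⟩ := mem_or_mem_of_mem_faceSubgroup_three (edge_eq_iff_mem.1 he)
  refine ⟨g, rfl, ?_⟩
  rcases h with h | h
  · refine absurd ?_ hne
    exact vtx_eq_iff_mem.2 (h ▸ hb)
  · rw [← vtx_mul hb, mul_assoc, ← h, mul_inv_cancel_left]
    rfl

/-! ### Shapes of vectors -/

/-- The shape of a vector. -/
def shape (v : Vec) : Shape := (v 0, {v 1, v 2, v 3, v 4})

theorem shape_reflVec {j : Fin 5} (h0 : j ≠ 0) (h4 : j ≠ 4) (v : Vec) :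
    shape (reflVec j v) = shape v := by
  fin_cases j
  · exact absurd rfl h0
  · exact Prod.ext rfl (Multiset.cons_swap (v 2) (v 1) {v 3, v 4})
  · exact Prod.ext rfl (congrArg (v 1 ::ₘ ·) (Multiset.cons_swap (v 3) (v 2) {v 4}))
  · exact Prod.ext rfl (congrArg (v 1 ::ₘ v 2 ::ₘ ·) (Multiset.cons_swap (v 4) (v 3) 0))
  · exact absurd rfl h4

theorem shape_reflVec_four (v : Vec) : shape (reflVec 4 v) = (shape v).move (v 4) := by
  have h : ({v 1, v 2, v 3, v 4} : Multiset ZPhi) = v 4 ::ₘ {v 1, v 2, v 3} := by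
    simp only [Multiset.insert_eq_cons, ← Multiset.singleton_add]; abel
  refine Prod.ext rfl ?_
  simp only [shape, Shape.move, h, Multiset.erase_cons_head]
  simp only [reflVec, cons_val, Multiset.insert_eq_cons, ← Multiset.singleton_add]; abel

theorem mem_shape (v : Vec) : v 4 ∈ (shape v).2 := by simp [shape]

/-- A permutation of the image of a list is induced by a permutation of the list. -/
theorem exists_perm_map_eq {α β : Type*} (f : α → β) {xs ys : List β} (h : xs.Perm ys) :
    ∀ z : List α, z.map f = xs → ∃ z' : List α, z.Perm z' ∧ z'.map f = ys := by
  induction h with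
  | nil => exact fun z hz => ⟨z, .refl _, hz⟩
  | cons a _ ih =>
    rintro (_ | ⟨b, z⟩) hz
    · simp at hz
    · simp only [List.map_cons, List.cons.injEq] at hz
      obtain ⟨z', h1, h2⟩ := ih z hz.2
      exact ⟨b :: z', h1.cons b, by simp [h2, hz.1]⟩
  | swap a b l =>
    rintro (_ | ⟨c, _ | ⟨d, z⟩⟩) hz
    · simp at hz
    · simp at hz
    · simp only [List.map_cons, List.cons.injEq] at hz
      exact ⟨d :: c :: z, .swap _ _ _, by simp [hz]⟩
  | trans _ _ ih1 ih2 =>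
    intro z hz
    obtain ⟨z', h1, h2⟩ := ih1 z hz
    obtain ⟨z'', h3, h4⟩ := ih2 z' h2
    exact ⟨z'', h1.trans h3, h4⟩

/-- Let a facet with normal `l` be perpendicular to the wall of `axis 4` and not contain the base
vertex, let `x` be a vertex on this facet and off the wall of `axis 4`, and `phi • x + l` the
neighbour of `x` off the facet. The distance between this neighbour and the upper neighbour of the
base vertex is at least the distance between `x` and the base vertex, minus one. -/
theorem depth_le_of_wall_vec {x l : Vec} (hx : shape x ∈ vertexShapes) (hl : shape l ∈ wallShapes)
    (hxl : form x l = 0) (hl0 : l 0 ≠ 0) (hl4 : l 4 = 0) (hx4 : x 4 ≠ 0) :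
    (shape x).depth ≤ (shape (reflVec 4 (phi • x + l))).depth + 1 := by
  obtain ⟨r, hr, hrx⟩ := List.mem_map.1 hx
  obtain ⟨n, hn, hnl⟩ := List.mem_map.1 hl
  obtain ⟨hr0, hrs⟩ := Prod.ext_iff.1 hrx
  obtain ⟨hn0, hns⟩ := Prod.ext_iff.1 hnl
  simp only [shape] at hr0 hn0
  replace hrs : [x 1, x 2, x 3, x 4].Perm r.2.1 := (Multiset.coe_eq_coe.1 hrs).symm
  replace hns : [l 1, l 2, l 3, l 4].Perm n.2 := (Multiset.coe_eq_coe.1 hns).symm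
  obtain ⟨z, hz, hzr⟩ := exists_perm_map_eq Prod.fst hrs
    [(x 1, l 1), (x 2, l 2), (x 3, l 3), (x 4, l 4)] rfl
  have hzl : (z.map Prod.snd).Perm n.2 := (hz.map Prod.snd).symm.trans hns
  have hzip : r.2.1.zip (z.map Prod.snd) = z := by
    rw [← hzr]; exact (List.zip_of_prod rfl rfl).symm
  have h := depth_le_of_wall r hr n hn (hn0 ▸ hl0) _ (List.mem_permutations'.2 hzl)
  rw [hzip] at h
  have hsum : (z.map fun q => q.1 * q.2).sum
      = x 1 * l 1 + x 2 * l 2 + x 3 * l 3 + x 4 * l 4 := by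
    rw [← (hz.map _).sum_eq]; simp [add_assoc]
  have hms : ((z.map fun q => phi * q.1 + q.2 : List ZPhi) : Multiset ZPhi) =
      (shape (phi • x + l)).2 := by
    rw [← Multiset.coe_eq_coe.2 (hz.map _)]; rfl
  have h' := h (by rw [hsum, hr0, hn0]; exact hxl) (x 4, l 4) (hz.subset (by simp)) hl4 hx4
  rw [hms, hr0, hn0, ← depth_table r hr] at h'
  rw [shape_reflVec_four, ← hrx]
  have h5 : (phi • x + l) 4 = phi * x 4 := by simp [hl4]
  rw [h5]
  exact h'

/-! ### Walks on a single cell -/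

/-- A word in `r₁, r₂, r₃` that moves `axis 4` to `axis i.succ`. -/
def turnWord (i : Fin 4) : List (Fin 5) := (carryWord i.succ 4).reverse

theorem turnWord_spec : ∀ i : Fin 4, 0 ∉ turnWord i ∧ 4 ∉ turnWord i ∧
    (turnWord i).foldr reflVec (axis 4) = axis i.succ := by
  decide +kernel

/-- The element of the stabilizer of the base vertex and the base cell that makes `axis i.succ` the
last axis. -/
noncomputable def turn (i : Fin 4) : Gam := word (turnWord i)

theorem turn_mem_zero (i : Fin 4) : turn i ∈ faceSubgroup 0 :=
  word_mem_faceSubgroup (turnWord_spec i).1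

theorem turn_mem_four (i : Fin 4) : turn i ∈ faceSubgroup 4 :=
  word_mem_faceSubgroup (turnWord_spec i).2.1

theorem act_turn_axis_zero (i : Fin 4) : act (turn i) (axis 0) = axis 0 :=
  act_axis_zero_of_mem (turn_mem_four i)

theorem act_turn_axis_four (i : Fin 4) : act (turn i) (axis 4) = axis i.succ := by
  rw [turn, act_word, (turnWord_spec i).2.2]

theorem shape_act_turn (i : Fin 4) (v : Vec) : shape (act (turn i) v) = shape v := by
  obtain ⟨h0, h4, -⟩ := turnWord_spec i
  rw [turn, act_word]
  revert h0 h4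
  generalize turnWord i = L
  intro h0 h4
  induction L with
  | nil => rfl
  | cons j L ih =>
    simp only [List.mem_cons, not_or] at h0 h4
    rw [List.foldr_cons, shape_reflVec (Ne.symm h0.1) (Ne.symm h4.1), ih h0.2 h4.2]

theorem shape_act_turn_inv (i : Fin 4) (v : Vec) : shape (act (turn i)⁻¹ v) = shape v := by
  rw [← shape_act_turn i, act_act_inv]

theorem phi_ne_zero : phi ≠ 0 := by decide

theorem act_turn_inv_four (i : Fin 4) (v : Vec) : act (turn i)⁻¹ v 4 = v i.succ := by
  apply mul_left_cancel₀ phi_ne_zero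
  rw [← form_axis (by decide), form_act_left, inv_inv, act_turn_axis_four,
    form_axis (Fin.succ_ne_zero i)]

/-- The move from a chamber along the `i`-th edge of its cell at its vertex. -/
noncomputable def step (i : Fin 4) : Gam := turn i * gen 4

theorem step_mem (i : Fin 4) : step i ∈ faceSubgroup 0 :=
  mul_mem (turn_mem_zero i) (gen_mem_faceSubgroup (by decide))

theorem act_step_axis_zero (i : Fin 4) : act (step i) (axis 0) = phi • axis 0 + axis i.succ := by
  rw [step, act_mul, act_gen, reflVec_four_axis_zero, act_add, act_smul, act_turn_axis_zero,
    act_turn_axis_four]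

theorem shape_mem_vertexShapes {h : Gam} (hh : h ∈ faceSubgroup 0) :
    shape (act h (axis 0)) ∈ vertexShapes := by
  refine faceSubgroup_induction (p := fun h => shape (act h (axis 0)) ∈ vertexShapes) ?_ ?_ hh
  · rw [act_one]; decide +kernel
  · intro j hj g ih
    rw [act_mul, act_gen]
    rcases eq_or_ne j 4 with rfl | h4
    · rw [shape_reflVec_four]
      exact (vertexShapes_move _ ih _ (mem_shape _)).1
    · rwa [shape_reflVec hj h4]

theorem shape_mem_wallShapes {h : Gam} (hh : h ∈ faceSubgroup 0) :
    shape (act h (axis 4)) ∈ wallShapes := by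
  refine faceSubgroup_induction (p := fun h => shape (act h (axis 4)) ∈ wallShapes) ?_ ?_ hh
  · rw [act_one]; decide +kernel
  · intro j hj g ih
    rw [act_mul, act_gen]
    rcases eq_or_ne j 4 with rfl | h4
    · rw [shape_reflVec_four]
      exact wallShapes_move _ ih _ (mem_shape _)
    · rwa [shape_reflVec hj h4]

/-- A vector proportional to the centre of the base 120-cell. -/
def center : Vec := ![phi + 1, 1, 1, 1, 1]

theorem act_center {h : Gam} (hh : h ∈ faceSubgroup 0) : act h center = center := by
  refine faceSubgroup_induction (p := fun h => act h center = center) (act_one _) ?_ hh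
  intro j hj g ih
  rw [act_mul, ih, act_gen]
  revert hj; revert j
  decide

theorem toReal_nonneg_of_mem {h : Gam} (hh : h ∈ faceSubgroup 0) {i : Fin 5} (hi : i ≠ 0) :
    0 ≤ toReal (act h (axis 0) i) := by
  have hm : act h (axis 0) i ∈ (shape (act h (axis 0))).2 := by
    fin_cases i
    · exact absurd rfl hi
    all_goals simp [shape]
  obtain ⟨h1, h2⟩ := vertexShapes_nonneg _ (shape_mem_vertexShapes hh) _ hm
  rw [toReal_apply]
  have := Real.goldenRatio_pos
  positivity

/-- For `h` in the stabilizer of the base cell, the distance in the graph of that cell between the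
base vertex and its image under `h`. -/
noncomputable def cellDepth (h : Gam) : ℕ := (shape (act h (axis 0))).depth

theorem cellDepth_one : cellDepth 1 = 0 := by
  rw [cellDepth, act_one]
  decide +kernel

theorem cellDepth_step_mul_le {h : Gam} (hh : h ∈ faceSubgroup 0) (i : Fin 4) :
    cellDepth (step i * h) ≤ cellDepth h + 1 := by
  rw [cellDepth, step, mul_assoc, act_mul, shape_act_turn, act_mul, act_gen, shape_reflVec_four]
  exact (vertexShapes_move _ (shape_mem_vertexShapes hh) _ (mem_shape _)).2

theorem exists_cellDepth_lt {h : Gam} (hh : h ∈ faceSubgroup 0) (h0 : cellDepth h ≠ 0) :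
    ∃ i, cellDepth ((step i)⁻¹ * h) < cellDepth h := by
  have := exists_move_depth_lt _ (shape_mem_vertexShapes hh) h0
  push Not at this
  obtain ⟨m, hm, hlt⟩ := this
  obtain ⟨i, rfl⟩ : ∃ i : Fin 4, m = act h (axis 0) i.succ := by
    simp only [shape, Multiset.insert_eq_cons, Multiset.mem_cons, Multiset.mem_singleton] at hm
    rcases hm with h | h | h | h
    exacts [⟨0, h⟩, ⟨1, h⟩, ⟨2, h⟩, ⟨3, h⟩]
  refine ⟨i, ?_⟩
  rw [cellDepth, step, _root_.mul_inv_rev, gen_inv, mul_assoc, act_mul, act_gen, shape_reflVec_four,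
    act_mul, shape_act_turn_inv, act_turn_inv_four]
  exact hlt

/-- The distance from the base vertex on the base cell is attained by a walk. -/
theorem exists_walk_length_le (n : ℕ) : ∀ g h : Gam, h ∈ faceSubgroup 0 → cellDepth h ≤ n →
    ∃ q : skeleton.Walk (vtx g) (vtx (g * h)), q.length ≤ n := by
  induction n with
  | zero =>
    intro g h hh hn
    have h1 := eq_of_depth_eq_zero _ (shape_mem_vertexShapes hh) (Nat.le_zero.1 hn)
    have h2 : vtx g = vtx (g * h) := by
      rw [vtx_mul]
      rw [mem_faceSubgroup_four_iff]
      obtain ⟨h3, h4⟩ := Prod.ext_iff.1 h1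
      have h5 : ∀ m ∈ (shape (act h (axis 0))).2, m = 0 := by
        rw [h4]; exact fun m hm => Multiset.eq_of_mem_replicate hm
      simp only [shape, Multiset.insert_eq_cons, Multiset.mem_cons, Multiset.mem_singleton] at h5
      funext i
      fin_cases i
      · exact h3
      all_goals exact h5 _ (by simp)
    exact ⟨SimpleGraph.Walk.nil.copy rfl h2, by simp⟩
  | succ n ih =>
    intro g h hh hn
    rcases Nat.lt_or_ge (cellDepth h) (n + 1) with hlt | hge
    · obtain ⟨q, hq⟩ := ih g h hh (Nat.lt_succ_iff.1 hlt)
      exact ⟨q, hq.trans n.le_succ⟩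
    · obtain ⟨i, hi⟩ := exists_cellDepth_lt hh (by omega)
      obtain ⟨q, hq⟩ := ih (g * step i) ((step i)⁻¹ * h) (mul_mem (inv_mem (step_mem i)) hh)
        (by omega)
      have hadj : skeleton.Adj (vtx g) (vtx (g * step i)) := by
        rw [← vtx_mul (g := g) (turn_mem_four i), step, ← mul_assoc]
        exact skeleton_adj_step _
      refine ⟨.cons hadj (q.copy rfl (by rw [mul_assoc, mul_inv_cancel_left])), ?_⟩
      simpa using hq

/-- A sequence of chambers of one cell, in which consecutive chambers differ by a move along an edge
of that cell. -/
def IsCellPath (F : ℕ → Gam) : Prop := ∀ k, ∃ i, F (k + 1) = F k * step i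

theorem IsCellPath.mem {F : ℕ → Gam} (hF : IsCellPath F) (m k : ℕ) :
    (F m)⁻¹ * F (m + k) ∈ faceSubgroup 0 := by
  induction k with
  | zero => simp
  | succ k ih =>
    obtain ⟨i, hi⟩ := hF (m + k)
    rw [← add_assoc, hi, ← mul_assoc]
    exact mul_mem ih (step_mem i)

theorem IsCellPath.cellDepth_le {F : ℕ → Gam} (hF : IsCellPath F) (k : ℕ) :
    ∀ m, cellDepth ((F m)⁻¹ * F (m + k)) ≤ k := by
  induction k with
  | zero => simp [cellDepth_one]
  | succ k ih =>
    intro m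
    obtain ⟨i, hi⟩ := hF m
    have h1 : (F m)⁻¹ * F (m + (k + 1)) = step i * ((F (m + 1))⁻¹ * F (m + 1 + k)) := by
      rw [hi, add_assoc, add_comm 1 k, _root_.mul_inv_rev, ← mul_assoc, ← mul_assoc, mul_inv_cancel,
        one_mul]
    rw [h1]
    exact (cellDepth_step_mul_le (hF.mem _ _) i).trans (Nat.succ_le_succ (ih _))

/-! ### Sides of walls -/

/-- The vector of a vertex. -/
noncomputable def position (v : Face 0) : Vec := act (exists_vtx v).choose (axis 0)

theorem position_vtx (g : Gam) : position (vtx g) = act g (axis 0) :=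
  vtx_eq_iff.1 (exists_vtx (vtx g)).choose_spec

/-- The sign of `side w v` tells on which side of the wall `w` the vertex `v` lies; it is `0` on the
wall. -/
noncomputable def side (w : Vec) (v : Face 0) : ℝ := toReal (form w (position v))

theorem side_neg (w : Vec) (v : Face 0) : side (-w) v = -side w v := by
  rw [side, form_neg_left, map_neg, side]

theorem side_eq_zero {w : Vec} {v : Face 0} : side w v = 0 ↔ form w (position v) = 0 :=
  map_eq_zero_iff _ toReal_injective

theorem act_mul_gen_four (g : Gam) :
    act (g * gen 4) (axis 0) = phi • act g (axis 0) + act g (axis 4) := by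
  rw [act_mul, act_gen, reflVec_four_axis_zero, act_add, act_smul]

theorem not_side_pos_neg {w : Vec} (hw : IsWall w) {g : Gam} (h0 : 0 < side w (vtx g))
    (h1 : side w (vtx (g * gen 4)) < 0) : False := by
  refine (hw.act g⁻¹).not_cross_edge (?_ : 0 < toReal (form (act g⁻¹ w) (axis 0))) ?_
  · rwa [form_act_left, inv_inv, ← position_vtx]
  · rwa [form_act_left, inv_inv, act_add, act_smul, ← act_mul_gen_four, ← position_vtx]

theorem side_nonneg_of_adj {w : Vec} (hw : IsWall w) {u v : Face 0} (h : skeleton.Adj u v)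
    (h0 : 0 < side w u) : 0 ≤ side w v := by
  obtain ⟨g, rfl, rfl⟩ := exists_of_skeleton_adj h
  by_contra! h1
  exact not_side_pos_neg hw h0 h1

theorem eq_axis_of_form_eq_zero {w : Vec} (hw : IsWall w) {g : Gam}
    (h : form w (act g (axis 0)) = 0) :
    ∃ i, i ≠ 0 ∧ (w = act g (axis i) ∨ w = act g (-axis i)) := by
  have h0 : act g⁻¹ w 0 = 0 := by
    rw [← inv_inv g, ← form_act_left, form_axis_zero] at h
    exact neg_eq_zero.1 h
  obtain ⟨i, hi, h'⟩ := (hw.act g⁻¹).eq_axis h0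
  refine ⟨i, hi, h'.imp ?_ ?_⟩ <;> intro e <;> rw [← e, act_act_inv]

/-- A wall that an edge leaves is perpendicular to that edge. -/
theorem eq_act_axis_four {w : Vec} (hw : IsWall w) {g : Gam}
    (h : form w (act g (axis 0)) = 0) (h' : form w (act (g * gen 4) (axis 0)) ≠ 0) :
    w = act g (axis 4) ∨ w = -act g (axis 4) := by
  rw [act_mul_gen_four, form_add_right, form_smul_right, h, mul_zero, zero_add] at h'
  obtain ⟨i, hi, e⟩ := eq_axis_of_form_eq_zero hw h
  have hi4 : i = 4 := by
    by_contra hi4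
    rcases e with rfl | rfl
    · exact h' (by rw [form_act, form_axis_axis hi4])
    · exact h' (by rw [form_act, form_neg_left, form_axis_axis hi4, neg_zero])
  subst hi4
  rwa [act_neg] at e

theorem form_act_axis_four_eq_zero_iff {u : Vec} {G : Gam}
    (e : u = act G (axis 4) ∨ u = -act G (axis 4)) (v : Vec) :
    form u v = 0 ↔ act G⁻¹ v 4 = 0 := by
  have h : form (act G (axis 4)) v = phi * act G⁻¹ v 4 := by
    rw [form_act_left, form_comm, form_axis (by decide)]
  rcases e with rfl | rfl
  · rw [h, mul_eq_zero, or_iff_right phi_ne_zero]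
  · rw [form_neg_left, h, neg_eq_zero, mul_eq_zero, or_iff_right phi_ne_zero]

/-- Two vertices on a wall `u` are only separated by walls perpendicular to `u`. -/
theorem form_eq_zero_of_separate {u w : Vec} (hw : IsWall w) {v v' : Face 0} (hu : IsWall u)
    (huv : side u v = 0) (huv' : side u v' = 0) (h : side w v < 0) (h' : 0 < side w v') :
    form w u = 0 := by
  obtain ⟨g, rfl⟩ := exists_vtx v
  obtain ⟨g', rfl⟩ := exists_vtx v'
  rw [side_eq_zero, position_vtx] at huv huv'
  rw [side, position_vtx] at h h'
  obtain ⟨i, hi, e⟩ := eq_axis_of_form_eq_zero hu huv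
  obtain ⟨i, rfl⟩ := Fin.exists_succ_eq.2 hi
  -- choose the frame so that `u` is the wall of `axis 4`
  have hG : act g (axis 0) = act (g * turn i) (axis 0) := by rw [act_mul, act_turn_axis_zero]
  replace e : u = act (g * turn i) (axis 4) ∨ u = -act (g * turn i) (axis 4) := by
    rwa [act_mul, act_turn_axis_four, ← act_neg]
  rw [hG] at h
  generalize g * turn i = G at e h
  by_contra hwu
  refine (hw.act G⁻¹).not_separate (b := act (G⁻¹ * g') (axis 0)) 
    (fun h4 => hwu (by rwa [form_comm, form_act_axis_four_eq_zero_iff e]))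
    (form_act_axis_zero _) ?_ (toReal_act_axis_zero_pos _) ?_ ?_
  · rw [act_mul, ← form_act_axis_four_eq_zero_iff e, huv']
  · rwa [form_act_left, inv_inv]
  · rwa [act_mul, form_act]

/-! ### Walks that cross no wall -/

/-- A walk that crosses no wall lies on a single cell: the one at its first vertex that lies, for
each of the four walls through this vertex, on the same side as the walk. -/
theorem exists_frames {x : ℕ → Face 0} {n : ℕ} (hx : ∀ k < n, skeleton.Adj (x k) (x (k + 1)))
    (hside : ∀ w, IsWall w → ∀ p ≤ n, ∀ q ≤ n, side w (x p) < 0 → side w (x q) ≤ 0) :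
    ∃ F : ℕ → Gam, IsCellPath F ∧ ∀ k ≤ n, x k = vtx (F k) := by
  classical
  obtain ⟨g, hg⟩ := exists_vtx (x 0)
  let ε : Fin 5 → Bool := fun j => decide (∃ p ≤ n, side (act g (axis j)) (x p) < 0)
  obtain ⟨hε4, hε⟩ := signWord_spec ε
  let G := g * word (signWord ε)
  have hG0 : vtx G = x 0 := by rw [← hg, vtx_mul (word_mem_faceSubgroup hε4)]
  have hG : ∀ j, j ≠ 0 → ∀ p ≤ n, 0 ≤ side (act G (axis j)) (x p) := by
    intro j hj p hp
    rw [act_mul, act_word, hε j hj]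
    split_ifs with h
    · obtain ⟨q, hq, hlt⟩ := of_decide_eq_true h
      rw [act_neg, side_neg]
      linarith [hside _ ((isWall_axis hj).act g) q hq p hp hlt]
    · by_contra! hlt
      exact h (decide_eq_true ⟨p, hp, hlt⟩)
  let next : ℕ → Gam → Fin 4 := fun k f =>
    if h : ∃ i, x (k + 1) = vtx (f * step i) then h.choose else 0
  let F : ℕ → Gam := fun k => Nat.rec G (fun k f => f * step (next k f)) k
  have hF : IsCellPath F := fun k => ⟨next k (F k), rfl⟩
  refine ⟨F, hF, fun k => ?_⟩
  induction k with
  | zero => exact fun _ => hG0.symm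
  | succ k ih =>
    intro hk
    have ih := ih (by omega)
    suffices h : ∃ i, x (k + 1) = vtx (F k * step i) by
      change x (k + 1) = vtx (F k * step (next k (F k)))
      simp only [next, dif_pos h]
      exact h.choose_spec
    obtain ⟨f, hf, hf'⟩ := exists_of_skeleton_adj (hx k (by omega))
    have hpos : act f (axis 0) = act (F k) (axis 0) := vtx_eq_iff.1 (hf.symm.trans ih)
    obtain ⟨i, hi, e⟩ := eq_axis_of_form_eq_zero ((isWall_axis (i := 4) (by decide)).act f)
      (g := F k) (by rw [← hpos, form_act, form_axis_axis (by decide)])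
    obtain ⟨i, rfl⟩ := Fin.exists_succ_eq.2 hi
    rcases e with e | e
    · refine ⟨i, ?_⟩
      rw [hf', vtx_eq_iff, act_mul_gen_four, hpos, e, act_mul, act_step_axis_zero, act_add,
        act_smul]
    · exfalso
      -- the edge leaves the cell through the wall of `F k`
      have hw := (isWall_axis hi).act (F k)
      have hneg : side (act (F k) (axis i.succ)) (x (k + 1)) < 0 := by
        rw [hf', side, position_vtx, act_mul_gen_four, hpos, e, form_add_right, form_smul_right,
          form_act, form_act, form_axis_axis hi, form_neg_right, isWall_axis hi, mul_zero, zero_add,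
          map_neg, toReal_phi]
        exact neg_neg_of_pos Real.goldenRatio_pos
      have hmem : (F k)⁻¹ * G ∈ faceSubgroup 0 := by
        have := inv_mem (hF.mem 0 k)
        rwa [zero_add, _root_.mul_inv_rev, inv_inv] at this
      have h0 : side (act (F k) (axis i.succ)) (x 0) = 0 := by
        refine le_antisymm (hside _ hw (k + 1) hk 0 (Nat.zero_le _) hneg) ?_
        rw [← hG0, side, position_vtx, form_act_left, ← act_mul, form_comm, form_axis hi, map_mul,
          toReal_phi]
        exact mul_nonneg Real.goldenRatio_pos.le (toReal_nonneg_of_mem hmem hi)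
      rw [← hG0, side_eq_zero, position_vtx] at h0
      obtain ⟨j, hj, h⟩ := eq_axis_of_form_eq_zero hw h0
      rcases h with h | h
      · rw [h] at hneg
        exact hneg.not_ge (hG j hj _ hk)
      · have h1 : form (act (F k) (axis i.succ)) (act G center) = phi := by
          rw [form_act_left, ← act_mul, act_center hmem, form_comm, form_axis hi]
          fin_cases i <;> decide
        rw [h, form_act] at h1
        revert h1 hj
        clear * -
        revert j
        decide

theorem liesOn_cell {u v : Face 0} (p : skeleton.Walk u v) : ∀ F : ℕ → Gam, IsCellPath F →
    (∀ k ≤ p.length, p.getVert k = vtx (F k)) → LiesOn p (cell (F 0)) := by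
  induction p with
  | nil =>
    intro F _ h
    have := h 0 le_rfl
    simp only [SimpleGraph.Walk.getVert_nil] at this
    refine ⟨?_, by simp⟩
    simp only [SimpleGraph.Walk.support_nil, List.mem_singleton, forall_eq]
    exact this ▸ incident_vtx_cell _
  | @cons u v w hadj p ih =>
    intro F hF h
    obtain ⟨i, hi⟩ := hF 0
    have hcell : cell (F 1) = cell (F 0) := by rw [hi, cell_mul (step_mem i)]
    obtain ⟨h1, h2⟩ := ih (fun k => F (k + 1)) (fun k => hF (k + 1)) (fun k hk => by
      have := h (k + 1) (by simpa using hk)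
      simpa using this)
    rw [zero_add, hcell] at h1 h2
    have hu : u = vtx (F 0) := by simpa using h 0 (Nat.zero_le _)
    have hv : v = vtx (F 1) := by simpa using h 1 (by simp)
    have hedge : edge (F 0 * turn i) = edge (F 1) := by
      rw [hi, step, ← mul_assoc, edge_mul (gen_mem_faceSubgroup (by decide))]
    refine ⟨?_, ?_⟩
    · intro a ha
      rw [SimpleGraph.Walk.support_cons, List.mem_cons] at ha
      rcases ha with rfl | ha
      · exact hu ▸ incident_vtx_cell _
      · exact h1 a ha
    · intro s hs
      rw [SimpleGraph.Walk.edges_cons, List.mem_cons] at hs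
      rcases hs with rfl | hs
      · refine ⟨edge (F 1), ?_, hcell ▸ incident_edge_cell _⟩
        intro a ha
        rcases Sym2.mem_iff.1 ha with rfl | rfl
        · rw [hu, ← vtx_mul (turn_mem_four i), ← hedge]
          exact incident_vtx_edge _
        · rw [hv]
          exact incident_vtx_edge _
      · exact h2 s hs

/-! ### Locally minimal walks -/

/-- A walk all of whose subwalks on a single cell are minimal. -/
def LocallyMinimal {u v : Face 0} (c : skeleton.Walk u v) : Prop :=
  ∀ (a b : Face 0) (p : skeleton.Walk a b), p.IsSubwalk c → (∃ P : Face 4, LiesOn p P) → IsMinimal p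

theorem LocallyMinimal.le_cellDepth {u v : Face 0} {c : skeleton.Walk u v} (hc : LocallyMinimal c)
    {i n : ℕ} (hn : i + n ≤ c.length) {F : ℕ → Gam} (hF : IsCellPath F)
    (hx : ∀ k ≤ n, c.getVert (i + k) = vtx (F k)) : n ≤ cellDepth ((F 0)⁻¹ * F n) := by
  let p := (c.drop i).take n
  have hlen : p.length = n := by
    simp only [p, SimpleGraph.Walk.take_length, SimpleGraph.Walk.drop_length]; omega
  have hvert : ∀ k ≤ n, p.getVert k = vtx (F k) := by
    intro k hk
    simp only [p, SimpleGraph.Walk.take_getVert, SimpleGraph.Walk.drop_getVert]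
    rw [min_eq_right hk, hx k hk]
  have hmin : IsMinimal p := hc _ _ p
    ((SimpleGraph.Walk.isSubwalk_take _ _).trans (SimpleGraph.Walk.isSubwalk_drop _ _))
    ⟨_, liesOn_cell p F hF fun k hk => hvert k (hlen ▸ hk)⟩
  have hmem := hF.mem 0 n
  rw [zero_add] at hmem
  obtain ⟨q, hq⟩ := exists_walk_length_le _ (F 0) _ hmem le_rfl
  have h0 : vtx (F 0) = c.getVert i := (hx 0 (Nat.zero_le n)).symm
  have h1 : vtx (F 0 * ((F 0)⁻¹ * F n)) = (c.drop i).getVert n := by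
    rw [mul_inv_cancel_left, SimpleGraph.Walk.drop_getVert, hx n le_rfl]
  have h2 := hmin (q.copy h0 h1)
  rw [hlen, SimpleGraph.Walk.length_copy] at h2
  exact h2.trans hq

/-- A chamber `G` with the same vertex and cell as `F k`, in which the edge to the next vertex is
the one along `axis 4`. -/
theorem IsCellPath.exists_frame {F : ℕ → Gam} (hF : IsCellPath F) (k : ℕ) : ∃ G : Gam,
    F (k + 1) = G * gen 4 ∧ act G (axis 0) = act (F k) (axis 0) ∧
      (∀ n, G⁻¹ * F (k + n) ∈ faceSubgroup 0) ∧
      ∀ h, cellDepth ((F k)⁻¹ * h) = cellDepth (G⁻¹ * h) := by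
  obtain ⟨i, hi⟩ := hF k
  refine ⟨F k * turn i, by rw [hi, step, mul_assoc], by rw [act_mul, act_turn_axis_zero],
    fun n => ?_, fun h => ?_⟩
  · rw [_root_.mul_inv_rev, mul_assoc]
    exact mul_mem (inv_mem (turn_mem_zero i)) (hF.mem k n)
  rw [cellDepth, cellDepth, _root_.mul_inv_rev, mul_assoc, act_mul (turn i)⁻¹, shape_act_turn_inv]

/-- On a cell, a minimal walk between two vertices of a facet does not leave the facet at its
start. -/
theorem LocallyMinimal.side_ne_zero_of_isCellPath {u v : Face 0} {c : skeleton.Walk u v}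
    (hc : LocallyMinimal c) {i n : ℕ} (hn : i + (n + 1) ≤ c.length) {F : ℕ → Gam}
    (hF : IsCellPath F) (hx : ∀ k ≤ n + 1, c.getVert (i + k) = vtx (F k)) {w : Vec} (hw : IsWall w)
    (h0 : side w (c.getVert i) = 0) (h1 : side w (c.getVert (i + 1)) ≠ 0) :
    side w (c.getVert (i + (n + 1))) ≠ 0 := by
  intro h2
  obtain ⟨G, hG, hG0, hmem, hdepth⟩ := hF.exists_frame 0
  replace hmem := hmem (n + 1)
  rw [zero_add] at hmem
  have hx0 := hx 0 (Nat.zero_le _)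
  rw [add_zero] at hx0
  rw [hx0, side_eq_zero, position_vtx, ← hG0] at h0
  rw [hx 1 (by omega), ne_eq, side_eq_zero, position_vtx, hG] at h1
  have e := eq_act_axis_four hw h0 h1
  rw [hx _ le_rfl, side_eq_zero, position_vtx, form_act_axis_four_eq_zero_iff e, ← act_mul] at h2
  have hle := hc.le_cellDepth hn hF hx
  rw [hdepth] at hle
  have hge := hF.cellDepth_le n 1
  rw [hG, add_comm 1 n, _root_.mul_inv_rev, gen_inv, mul_assoc, cellDepth, act_mul, act_gen,
    shape_reflVec_four, h2] at hge
  have h3 := depth_le_move_zero _ (shape_mem_vertexShapes hmem) (h2 ▸ mem_shape _)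
  rw [cellDepth] at hle
  omega

/-- On a cell, a minimal walk that leaves a facet at its start does not end by stepping onto a
perpendicular facet. -/
theorem LocallyMinimal.not_reach_of_isCellPath {u v : Face 0} {c : skeleton.Walk u v}
    (hc : LocallyMinimal c) {i n : ℕ} (hn : i + (n + 1) ≤ c.length) {F : ℕ → Gam}
    (hF : IsCellPath F) (hx : ∀ k ≤ n + 1, c.getVert (i + k) = vtx (F k)) {w l : Vec}
    (hw : IsWall w) (hl : IsWall l) (hlw : form l w = 0)
    (h0 : side w (c.getVert i) = 0) (h1 : side w (c.getVert (i + 1)) ≠ 0)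
    (h2 : side w (c.getVert (i + (n + 1))) ≠ 0)
    (hl0 : side l (c.getVert i) ≠ 0) (hl1 : side l (c.getVert (i + n)) ≠ 0)
    (hl2 : side l (c.getVert (i + (n + 1))) = 0) : False := by
  obtain ⟨G, hG, hG0, hmem, hdepth⟩ := hF.exists_frame 0
  replace hmem := hmem (n + 1)
  rw [zero_add] at hmem
  have hx0 := hx 0 (Nat.zero_le _)
  rw [add_zero] at hx0
  rw [hx0, side_eq_zero, position_vtx, ← hG0] at h0
  rw [hx0, ne_eq, side_eq_zero, position_vtx, ← hG0] at hl0
  rw [hx 1 (by omega), ne_eq, side_eq_zero, position_vtx, hG] at h1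
  have e := eq_act_axis_four hw h0 h1
  rw [hx _ le_rfl, ne_eq, side_eq_zero, position_vtx, form_act_axis_four_eq_zero_iff e,
    ← act_mul] at h2
  -- the last edge is perpendicular to the wall of `axis 4` in the last frame
  obtain ⟨K, hK, hK0, -, -⟩ := hF.exists_frame n
  have hlast : act (F (n + 1) * gen 4) (axis 0) = act (F n) (axis 0) := by
    rw [hK, mul_assoc, gen_mul_self, mul_one, hK0]
  rw [hx n n.le_succ, ne_eq, side_eq_zero, position_vtx, ← hlast] at hl1
  rw [hx _ le_rfl, side_eq_zero, position_vtx] at hl2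
  have e' := eq_act_axis_four hl hl2 hl1
  have hl4 : act (G⁻¹ * F (n + 1)) (axis 4) 4 = 0 := by
    rw [form_comm, form_act_axis_four_eq_zero_iff e] at hlw
    rw [act_mul]
    rcases e' with rfl | rfl
    · exact hlw
    · rwa [act_neg, Pi.neg_apply, neg_eq_zero] at hlw
  have hl0' : act (G⁻¹ * F (n + 1)) (axis 4) 0 ≠ 0 := by
    intro h
    apply hl0
    rw [← neg_eq_zero, ← form_axis_zero, act_mul, form_act_left, inv_inv] at h
    rcases e' with rfl | rfl
    · exact h
    · rw [form_neg_left, h, neg_zero]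
  have hxl : form (act (G⁻¹ * F (n + 1)) (axis 0)) (act (G⁻¹ * F (n + 1)) (axis 4)) = 0 := by
    rw [form_act, form_axis_axis (by decide)]
  have hfact := depth_le_of_wall_vec (shape_mem_vertexShapes hmem) (shape_mem_wallShapes hmem) hxl
    hl0' hl4 h2
  rw [← act_mul_gen_four, mul_assoc, act_mul G⁻¹ (F (n + 1) * gen 4), hlast, ← act_mul, ← act_gen, ← act_mul] at hfact
  have hle := hc.le_cellDepth hn hF hx
  rw [hdepth, cellDepth] at hle
  rcases n with _ | m
  · rw [zero_add, hG, inv_mul_cancel_left, act_gen, reflVec_four_axis_four] at hl4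
    exact absurd hl4 (by decide)
  · have hge := hF.cellDepth_le m 1
    rw [hG, add_comm 1 m, _root_.mul_inv_rev, gen_inv, mul_assoc, cellDepth] at hge
    omega

/-- A locally minimal walk does not return to a wall that it leaves. -/
theorem LocallyMinimal.side_ne_zero {u v : Face 0} {c : skeleton.Walk u v}
    (hc : LocallyMinimal c) (d : ℕ) : ∀ i, i + (d + 1) ≤ c.length → ∀ w, IsWall w →
      side w (c.getVert i) = 0 → side w (c.getVert (i + 1)) ≠ 0 →
      side w (c.getVert (i + (d + 1))) ≠ 0 := by
  induction d using Nat.strong_induction_on with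
  | _ d ih =>
  intro i hi w hw h0 h1 h2
  -- shorter subwalks meet each wall in an interval
  have hint : ∀ l, IsWall l → ∀ p q r, p ≤ q → q ≤ r → r ≤ c.length → r ≤ p + d →
      side l (c.getVert p) = 0 → side l (c.getVert r) = 0 → side l (c.getVert q) = 0 := by
    intro l hl p q r hpq hqr hr hrd hp hr0
    induction q, hpq using Nat.le_induction with
    | base => exact hp
    | succ q hpq ihq =>
      by_contra hq
      obtain ⟨m, rfl⟩ : ∃ m, r = q + (m + 1) := ⟨r - q - 1, by omega⟩
      exact ih m (by omega) q hr l hl (ihq (by omega)) hq hr0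
  have hadj : ∀ k, k < c.length → skeleton.Adj (c.getVert k) (c.getVert (k + 1)) :=
    fun k hk => c.adj_getVert_succ hk
  by_cases hcross : ∃ k, k ≤ d + 1 ∧ ∃ l, IsWall l ∧ ∃ p < k,
      side l (c.getVert (i + p)) < 0 ∧ 0 < side l (c.getVert (i + k))
  · classical
    obtain ⟨hk, l, hl, p, hp, hpneg, hkpos⟩ := Nat.find_spec hcross
    have hmin := fun m => Nat.find_min hcross (m := m)
    generalize Nat.find hcross = k at *
    have hle : ∀ l, IsWall l → ∀ p < k, ∀ q < k, side l (c.getVert (i + p)) < 0 →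
        side l (c.getVert (i + q)) ≤ 0 := by
      intro l hl p hp q hq hneg
      by_contra! hpos
      rcases lt_trichotomy p q with h | rfl | h
      · exact hmin q hq ⟨by omega, l, hl, p, h, hneg, hpos⟩
      · exact lt_asymm hneg hpos
      · exact hmin p hp ⟨by omega, -l, hl.neg, q, h, by rw [side_neg]; linarith,
          by rw [side_neg]; linarith⟩
    obtain ⟨k, rfl⟩ : ∃ m, k = m + 1 := ⟨k - 1, by omega⟩
    have hk0 : side l (c.getVert (i + k)) = 0 := by
      refine le_antisymm (hle l hl p hp k k.lt_succ_self hpneg) ?_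
      by_contra! hneg
      have := side_nonneg_of_adj hl.neg (hadj (i + k) (by omega)) (by rw [side_neg]; linarith)
      rw [side_neg, add_assoc] at this
      linarith
    -- the first arrival at `l` after `p`
    have hex : ∃ s, p ≤ s ∧ side l (c.getVert (i + s)) = 0 := ⟨k, by omega, hk0⟩
    obtain ⟨hps, hs0⟩ := Nat.find_spec hex
    have hsmin := fun m => Nat.find_min hex (m := m)
    have hsk : Nat.find hex ≤ k := Nat.find_min' hex ⟨by omega, hk0⟩
    generalize Nat.find hex = s at *
    have hps' : p ≠ s := by rintro rfl; exact hpneg.ne hs0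
    obtain ⟨s, rfl⟩ : ∃ m, s = m + 1 := ⟨s - 1, by omega⟩
    have hs1 : side l (c.getVert (i + s)) ≠ 0 := fun h => hsmin s (by omega) ⟨by omega, h⟩
    have hl0 : side l (c.getVert i) ≠ 0 := fun h =>
      hs1 (hint l hl i (i + s) (i + (s + 1)) (by omega) (by omega) (by omega) (by omega) h hs0)
    have hlneg : side l (c.getVert i) < 0 :=
      lt_of_le_of_ne (by simpa using hle l hl p hp 0 (by omega) hpneg) hl0
    have hlpos : ∀ m, k + 1 ≤ m → m ≤ d + 1 → 0 < side l (c.getVert (i + m)) := by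
      intro m hm
      induction m, hm using Nat.le_induction with
      | base => exact fun _ => hkpos
      | succ m hm ihm =>
        intro hmd
        refine lt_of_le_of_ne (side_nonneg_of_adj hl (hadj (i + m) (by omega))
          (ihm (by omega))) fun h => ?_
        exact hkpos.ne' (hint l hl (i + k) (i + (k + 1)) (i + (m + 1)) (by omega) (by omega)
          (by omega) (by omega) hk0 h.symm)
    have hperp : form l w = 0 :=
      form_eq_zero_of_separate hl hw h0 h2 hlneg (hlpos (d + 1) (by omega) le_rfl)
    obtain ⟨F, hF, hFx⟩ := exists_frames (x := fun m => c.getVert (i + m)) (n := s + 1)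
      (fun m hm => hadj (i + m) (by omega))
      (fun l hl p hp q hq => hle l hl p (by omega) q (by omega))
    exact hc.not_reach_of_isCellPath (by omega) hF hFx hw hl hperp h0 h1
      (ih s (by omega) i (by omega) w hw h0 h1) hl0 hs1 hs0
  · obtain ⟨F, hF, hFx⟩ := exists_frames (x := fun m => c.getVert (i + m)) (n := d + 1)
      (fun m hm => hadj (i + m) (by omega)) (fun l hl p hp q hq hneg => by
        by_contra! hpos
        apply hcross
        rcases lt_trichotomy p q with h | rfl | h
        · exact ⟨q, hq, l, hl, p, h, hneg, hpos⟩
        · exact absurd hneg hpos.not_gt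
        · exact ⟨p, hp, -l, hl.neg, q, h, by rw [side_neg]; linarith,
            by rw [side_neg]; linarith⟩)
    exact hc.side_ne_zero_of_isCellPath hi hF hFx hw h0 h1 h2

end GoldenTessellation

open GoldenTessellation
theorem lemma5p2 (v : Face 0) (c : skeleton.Walk v v) (hc : 0 < c.length) :
    ∃ (a b : Face 0) (p : skeleton.Walk a b),
      p.IsSubwalk c ∧ (∃ P : Face 4, LiesOn p P) ∧ ¬ IsMinimal p := by
  by_contra! hmin
  obtain ⟨n, hn⟩ : ∃ n, c.length = n + 1 := ⟨c.length - 1, by omega⟩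
  -- the wall that the first edge leaves
  obtain ⟨g, h0, h1⟩ := exists_of_skeleton_adj (c.adj_getVert_succ hc)
  have hw : IsWall (act g (axis 4)) := (isWall_axis (by decide)).act g
  have hside0 : side (act g (axis 4)) (c.getVert 0) = 0 := by
    rw [h0, side_eq_zero, position_vtx, form_act, form_axis_axis (by decide)]
  refine LocallyMinimal.side_ne_zero (c := c) hmin n 0 (by omega) _ hw hside0 ?_ ?_
  · rw [h1, ne_eq, side_eq_zero, position_vtx, act_mul_gen_four, form_add_right, form_smul_right,
      form_act, form_act, form_axis_axis (by decide), isWall_axis (i := 4) (by decide)]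
    simpa using phi_ne_zero
  · rw [zero_add, ← hn, SimpleGraph.Walk.getVert_length]
    rwa [SimpleGraph.Walk.getVert_zero] at hside0
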